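/- **Setting.** Let $X\subset\mathbb R^n$ be compact and convex with diameter $D_X>0$, let $F:X\to\mathbb R^n$ be monotone, and let $g=(g_1,\dots,g_m):X\to\mathbb R^m$ have continuous convex components with selected (measurable) subgradients $\nabla g_j(x)\in\partial g_j(x)$, $x\in X$. For constants $L,H,L_{g_j},H_{g_j}\ge 0$ and $M_g>0$ assume, for all $x,y\in X$, $$\|F(x)-F(y)\|\le L\|x-y\|+H,\qquad g_j(x)-g_j(y)-\langle\nabla g_j(y),x-y\rangle\le \tfrac{L_{g_j}}2\|x-y\|^2+H_{g_j}\|x-y\|,$$ $\|g(x)-g(y)\|\le M_g\|x-y\|$, and $\|\nabla g(x)\|\le M_g$ (spectral norm of $\nabla g(x)=[\nabla g_1(x),\dots,\nabla g_m(x)]$). Put $L_g=(\sum_jL_{g_j}^2)^{1/2}$ and $H_g=(\sum_jH_{g_j}^2)^{1/2}$. Let $\widetilde X=\{x\in X: g(x)\le 0\}$, and let $(x^*,\lambda^*)\in\widetilde X\times\mathbb R^m_+$ be a KKT pair: $$0\in F(x^*)+\sum_j\lambda^*_j\,\partial g_j(x^*)+N_X(x^*),\qquad \lambda^*_jg_j(x^*)=0\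 \text{ for all } j.$$ The operator is accessed through a (jointly measurable) stochastic oracle $\mathfrak F(x,\xi)$ with $\mathbb E[\mathfrak F(x,\xi)]=F(x)$ and $\mathbb E\|\mathfrak F(x,\xi)-F(x)\|^2\le\sigma^2$ for every $x\in X$, where $\sigma\ge 0$. Let $\xi^0,\xi^1,\dots$ be i.i.d. copies of $\xi$. **Algorithm (StOpConEx).** Let $x^{-1}=x^0\in X$ be deterministic, $\lambda^0=0$, $\mathfrak F^t=\mathfrak F(x^t,\xi^t)$, $\mathfrak F^{-1}=\mathfrak F^0$, $\ell_g(x^0)=\ell_g(x^{-1})=g(x^0)$ and $\ell_g(x^t)=g(x^{t-1})+\nabla g(x^{t-1})^{T}(x^t-x^{t-1})$. For $t=0,\dots,T-1$ (one oracle sample per iteration), $$s^t=(1+\theta_t)\ell_g(x^t)-\theta_t\ell_g(x^{t-1}),\qquad \lambda^{t+1}=\arg\min_{\lambda\ge0}\ \langle -s^t,\lambda\rangle+\tfrac{\tau_t}2\|\lambda-\lambda^t\|^2,$$ $$x^{t+1}=\arg\min_{x\in X}\ \Big\langle(1+\theta_t)\mathfrak F^t-\theta_t\mathfrak F^{t-1}+\sum_j\lambda^{t+1}_j\nabla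 g_j(x^t),\,x\Big\rangle+\tfrac{\eta_t}2\|x-x^t\|^2,$$ with output $\bar x_T=\big(\sum_{t<T}\gamma_tx^{t+1}\big)/\sum_{t<T}\gamma_t$. **Theorem.** Let $B\ge1$, $T\ge1$, $\gamma_t=\theta_t=1$, $\tau_t=\frac{6M_gD_X}{B}$ and $$\eta_t=L_gB+8L+\tfrac{5M_gB}{D_X}+\tfrac{2(H+H_gB+\sqrt3\sigma)}{D_X}\sqrt T .$$ Then the weak gap $\sup_{x\in\widetilde X}\langle F(x),\bar x_T-x\rangle$ is integrable and $$\mathbb E\Big[\sup_{x\in\widetilde X}\langle F(x),\bar x_T-x\rangle\Big]\le\frac1T\Big[8LD_X^2+BL_gD_X^2+5M_gD_X\Big(B+\tfrac{(\|\lambda^*\|+1)^2}B\Big)\Big]+\frac{4D_X}{\sqrt T}\big[H+\sqrt3\sigma\big]+\frac{2D_XH_gB}{\sqrt T}.$$ With $\mathcal H_*=H_g(\|\lambda^*\|+1)+\frac{L_gD_X[\|\lambda^*\|+1-B]_+}2$, suppose in addition that $H+H_gB+\sqrt3\sigma>0$, or that $\mathcal H_*=0$ (with the quotient below then read as $0$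 if its denominator vanishes). Then the infeasibility $\|[g(\bar x_T)]_+\|$ is integrable and $$\mathbb E\big\|[g(\bar x_T)]_+\big\|\le\frac1T\Big[4LD_X^2+\tfrac{BL_gD_X^2}2+3M_gD_X\Big(B+\tfrac{(\|\lambda^*\|+1)^2}B\Big)\Big]+\frac{4D_X}{\sqrt T}\Big[H+\sqrt2\sigma+\tfrac{\mathcal H_*^2}{H+H_gB+\sqrt3\sigma}\Big]+\frac{D_XH_gB}{\sqrt T}.$$ Consequently the sample complexity is $O(1/\varepsilon^2)$: write the two bounds as $\frac{a_1}T+\frac{b_1}{\sqrt T}$ and $\frac{a_2}T+\frac{b_2}{\sqrt T}$. Under the same additional condition, for every $\varepsilon>0$, if $T\ge\max\{a_1+b_1,a_2+b_2\}^2/\varepsilon^2$, then the expected weak gap and the expected infeasibility of $\bar x_T$ are both at most $\varepsilon$. -/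

import Mathlib

open scoped RealInnerProductSpace
open MeasureTheory ProbabilityTheory

noncomputable section

/-- Euclidean space of dimension `k`. -/
abbrev Euc (k : ℕ) : Type := EuclideanSpace ℝ (Fin k)

/-- Subdifferential at `x` of a function `h` considered on the set `X`. -/
def subdifferentialOn {n : ℕ} (X : Set (Euc n)) (h : Euc n → ℝ) (x : Euc n) : Set (Euc n) :=
  {v | ∀ y ∈ X, h x + ⟪v, y - x⟫ ≤ h y}

/-- Normal cone of `X` at `x`. -/
def normalConeAt {n : ℕ} (X : Set (Euc n)) (x : Euc n) : Set (Euc n) :=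
  {v | ∀ y ∈ X, ⟪v, y - x⟫ ≤ 0}

/-- Nonnegative orthant. -/
def nonnegOrthant (m : ℕ) : Set (Euc m) := {l | ∀ j, 0 ≤ l j}

/-- Componentwise positive part. -/
def vecPosPart {m : ℕ} (v : Euc m) : Euc m := WithLp.toLp 2 (fun j => max (v j) 0)

/-- Data of a function-constrained variational inequality: the simple set `X`, the operator `F`,
the constraint map `g = (g_1, …, g_m)` and the selected (sub)gradients `G j = ∇ g_j`.
Only the values on `X` matter. -/
structure FCVI (n m : ℕ) where
  X : Set (Euc n)
  F : Euc n → Euc n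
  g : Euc n → Euc m
  G : Fin m → Euc n → Euc n

namespace FCVI

variable {n m : ℕ}

/-- The constraint set `X ∩ {g ≤ 0}` of the variational inequality. -/
def feasible (P : FCVI n m) : Set (Euc n) := {x | x ∈ P.X ∧ ∀ j, P.g x j ≤ 0}

/-- The diameter of `X`. -/
def diamX (P : FCVI n m) : ℝ := Metric.diam P.X

/-- `∇g(x)ᵀ v`, the vector with entries `⟨∇g_j(x), v⟩`. -/
def gradT (P : FCVI n m) (x v : Euc n) : Euc m := WithLp.toLp 2 (fun j => ⟪P.G j x, v⟫)

/-- The standing assumptions on the data, with constants `L`, `H` for `F`, `Lc j`, `Hc j` for `g_j`,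
and `Mg` for the Lipschitz constant of `g` and the spectral norm of `∇g`. -/
structure Standing (P : FCVI n m) (L H Mg : ℝ) (Lc Hc : Fin m → ℝ) : Prop where
  compact_X : IsCompact P.X
  convex_X : Convex ℝ P.X
  monotone_F : ∀ x ∈ P.X, ∀ y ∈ P.X, 0 ≤ ⟪P.F x - P.F y, x - y⟫
  lipschitz_F : ∀ x ∈ P.X, ∀ y ∈ P.X, ‖P.F x - P.F y‖ ≤ L * ‖x - y‖ + H
  continuous_g : ContinuousOn P.g P.X
  convex_g : ∀ j, ConvexOn ℝ P.X (fun x => P.g x j)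
  subgradient_G : ∀ j, ∀ x ∈ P.X, P.G j x ∈ subdifferentialOn P.X (fun y => P.g y j) x
  measurable_G : ∀ j, Measurable (P.G j)
  lipschitz_type_g : ∀ j, ∀ x ∈ P.X, ∀ y ∈ P.X,
    P.g x j - P.g y j - ⟪P.G j y, x - y⟫ ≤ Lc j / 2 * ‖x - y‖ ^ 2 + Hc j * ‖x - y‖
  lipschitz_g : ∀ x ∈ P.X, ∀ y ∈ P.X, ‖P.g x - P.g y‖ ≤ Mg * ‖x - y‖
  bounded_G : ∀ x ∈ P.X, ∀ v : Euc n, ‖P.gradT x v‖ ≤ Mg * ‖v‖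
  L_nonneg : 0 ≤ L
  H_nonneg : 0 ≤ H
  Mg_pos : 0 < Mg
  Lc_nonneg : ∀ j, 0 ≤ Lc j
  Hc_nonneg : ∀ j, 0 ≤ Hc j

/-- `(xs, ls)` is a KKT pair of the variational inequality:
`0 ∈ F(xs) + ∑ ls_j ∂g_j(xs) + N_X(xs)`, with feasibility and complementary slackness. -/
structure IsKKT (P : FCVI n m) (xs : Euc n) (ls : Euc m) : Prop where
  primal_feasible : xs ∈ P.feasible
  dual_feasible : ls ∈ nonnegOrthant m
  stationary : ∃ v : Fin m → Euc n, ∃ w ∈ normalConeAt P.X xs,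
    (∀ j, v j ∈ subdifferentialOn P.X (fun y => P.g y j) xs) ∧
      P.F xs + ∑ j, ls j • v j + w = 0
  complementary : ∀ j, ls j * P.g xs j = 0

/-- Stochastic oracle: `Fr x ξ` with `ξ ∼ ν` is an unbiased estimator of `F x` with variance
at most `σ ^ 2`, for every `x ∈ X`. -/
structure IsOracle (P : FCVI n m) {Ξ : Type*} [MeasurableSpace Ξ] (ν : Measure Ξ)
    (Fr : Euc n → Ξ → Euc n) (σ : ℝ) : Prop where
  measurable : Measurable (fun p : Euc n × Ξ => Fr p.1 p.2)
  integrable : ∀ x ∈ P.X, Integrable (Fr x) ν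
  unbiased : ∀ x ∈ P.X, ∫ s, Fr x s ∂ν = P.F x
  variance_le : ∀ x ∈ P.X, ∫⁻ s, ‖Fr x s - P.F x‖ₑ ^ 2 ∂ν ≤ ENNReal.ofReal (σ ^ 2)

/-- Linearization `ℓ_g(x^t) = g(x^{t-1}) + ∇g(x^{t-1})ᵀ (x^t - x^{t-1})` along a sequence.
Since `0 - 1 = 0` in `ℕ`, the index `-1` is read as `0`; this encodes `x^{-1} = x^0` and
`ℓ_g(x^0) = ℓ_g(x^{-1}) = g(x^0)`. -/
def lin (P : FCVI n m) (x : ℕ → Euc n) (t : ℕ) : Euc m :=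
  P.g (x (t - 1)) + P.gradT (x (t - 1)) (x t - x (t - 1))

/-- `T` iterations of StOpConEx started at `x0`, with step-size parameters `θ`, `η`, `τ`, when the
oracle `Fr` receives the sample `s t` at iteration `t`: one oracle value `Fr (x t) (s t)` per
iteration, with the convention `Fr^{-1} = Fr^0` (again by `0 - 1 = 0`). -/
structure IsStOpConExRun (P : FCVI n m) {Ξ : Type*} (Fr : Euc n → Ξ → Euc n) (x0 : Euc n)
    (θ η τ : ℕ → ℝ) (T : ℕ) (s : ℕ → Ξ) (x : ℕ → Euc n) (l : ℕ → Euc m) : Prop where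
  init_x : x 0 = x0
  init_l : l 0 = 0
  dual_mem : ∀ t < T, l (t + 1) ∈ nonnegOrthant m
  dual_min : ∀ t < T, IsMinOn
    (fun u : Euc m => ⟪-((1 + θ t) • P.lin x t - θ t • P.lin x (t - 1)), u⟫
      + τ t / 2 * ‖u - l t‖ ^ 2) (nonnegOrthant m) (l (t + 1))
  primal_mem : ∀ t < T, x (t + 1) ∈ P.X
  primal_min : ∀ t < T, IsMinOn
    (fun z : Euc n => ⟪(1 + θ t) • Fr (x t) (s t) - θ t • Fr (x (t - 1)) (s (t - 1))
        + ∑ j, l (t + 1) j • P.G j (x t), z⟫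
      + η t / 2 * ‖z - x t‖ ^ 2) P.X (x (t + 1))

/-- The weak gap `sup_{y ∈ X, g(y) ≤ 0} ⟨F(y), z - y⟩`. -/
def weakGap (P : FCVI n m) (z : Euc n) : ℝ := sSup ((fun y => ⟪P.F y, z - y⟫) '' P.feasible)

/-- The infeasibility `‖[g(z)]_+‖`. -/
def infeasibility (P : FCVI n m) (z : Euc n) : ℝ := ‖vecPosPart (P.g z)‖

/-- The random point `z` is a stochastic `ε`-solution. -/
def IsStochSolution (P : FCVI n m) {Ω : Type*} [MeasurableSpace Ω] (μ : Measure Ω)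
    (z : Ω → Euc n) (ε : ℝ) : Prop :=
  (Integrable (fun ω => P.weakGap (z ω)) μ ∧ ∫ ω, P.weakGap (z ω) ∂μ ≤ ε) ∧
    (Integrable (fun ω => P.infeasibility (z ω)) μ ∧ ∫ ω, P.infeasibility (z ω) ∂μ ≤ ε)

end FCVI

/-- The output `(∑_{t<T} γ_t x^{t+1}) / ∑_{t<T} γ_t`. -/
def weightedOutput {n : ℕ} (γ : ℕ → ℝ) (x : ℕ → Euc n) (T : ℕ) : Euc n :=
  (∑ t ∈ Finset.range T, γ t)⁻¹ • ∑ t ∈ Finset.range T, γ t • x (t + 1)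

/-- `(∑ c_j ^ 2) ^ (1/2)`, the passage from `L_{g_j}`, `H_{g_j}` to `L_g`, `H_g`. -/
def l2Combine {m : ℕ} (c : Fin m → ℝ) : ℝ := √(∑ j, c j ^ 2)

/-- The primal parameter
`η_t = L_g B + 8 L + 5 M_g B / D + 2 (H + H_g B + √3 σ) √T / D`. -/
def primalStep (L Lg Mg H Hg σ D B : ℝ) (T : ℕ) : ℝ :=
  Lg * B + (8 * L + 5 * Mg * B / D + 2 * (H + Hg * B + √3 * σ) / D * √(T : ℝ))

/-- The dual parameter `τ_t = 6 M_g D / B`. -/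
def dualStep (Mg D B : ℝ) : ℝ := 6 * Mg * D / B

/-- `ℋ_* = H_g (r + 1) + L_g D [r + 1 - B]_+ / 2`, where `r` is the norm of the multiplier. -/
def calH (Lg Hg D B r : ℝ) : ℝ := Hg * (r + 1) + Lg * D * max (r + 1 - B) 0 / 2

/-- Coefficient of `1 / T` in the bound on the weak gap. -/
def gapCoeffT (L Lg Mg D B r : ℝ) : ℝ :=
  8 * L * D ^ 2 + B * Lg * D ^ 2 + 5 * Mg * D * (B + (r + 1) ^ 2 / B)

/-- Coefficient of `1 / √T` in the bound on the weak gap. -/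
def gapCoeffSqrt (H Hg σ D B : ℝ) : ℝ :=
  4 * D * (H + √3 * σ) + 2 * D * (Hg * B)

/-- Coefficient of `1 / T` in the bound on the infeasibility. -/
def feasCoeffT (L Lg Mg D B r : ℝ) : ℝ :=
  4 * L * D ^ 2 + B * Lg * D ^ 2 / 2 + 3 * Mg * D * (B + (r + 1) ^ 2 / B)

/-- Coefficient of `1 / √T` in the bound on the infeasibility. -/
def feasCoeffSqrt (Lg H Hg σ D B r : ℝ) : ℝ :=
  4 * D * (H + √2 * σ + calH Lg Hg D B r ^ 2 / (H + Hg * B + √3 * σ)) + D * (Hg * B)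

end

/-! The argument is a Lyapunov analysis along each trajectory, followed by taking expectations. For
every feasible `z` and multiplier `u ≥ 0`, adding the three-point inequalities of the primal and
dual proximal steps bounds `⟪F(x^{t+1}), x^{t+1} - z⟫ + ⟪u, g(x^{t+1})⟫` by a drop of a potential, a
noise term `-⟪e^t, x^t - z⟫` and a residual in the step length `p = ‖x^{t+1} - x^t‖`
(`Standing.step_le`). The extrapolation in both steps makes the differences of operator values and
of linearizations telescope. What is left of them is absorbed by Young's inequality, using squares
of earlier step lengths stored in the potential.

The choice of `η` turns the residual into at most `(h + Y) p - (N √T / D) p ^ 2`, with `N = H + H_g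
B + √3 σ`, `h = H + ℋ` (`ℋ` being `calH`) and `Y` the norm of the noise increment; completing the
square bounds it independently of `p` (`le_quadGain`). Summation gives `Standing.sum_le_pathBound`,
whose right side involves neither `z` nor `u`. Hence suprema over `z`, and multipliers depending on
the sample, may be taken before the expectation.

In expectation the noise is a martingale difference sequence: `⟪e^t, x^t - x^0⟫` has mean zero, `‖∑
e^t‖` has mean at most `√T σ`, and the squared increments have mean at most `2 σ ^ 2`
(`IsMartingaleDifference.pathBound_expectation`).

Monotonicity of `F` and convexity of `g` pass from iterates to their average. Then `u = 0` yields
the weak gap, while `z = x^*` and a multiplier of norm at most `‖λ^*‖ + 1` along `[g]_+` yield the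
infeasibility (`IsKKT.infeasibility_le`). -/

/-! ### Proximal steps, projections and the nonnegative orthant. -/

section Geometry

variable {k : ℕ}

/-- First-order optimality condition of a proximal step. -/
theorem inner_add_nonneg_of_isMinOn_prox {K : Set (Euc k)} (hK : Convex ℝ K) {v a u : Euc k} {η : ℝ}
    (hu : u ∈ K) (hmin : IsMinOn (fun z : Euc k => ⟪v, z⟫ + η / 2 * ‖z - a‖ ^ 2) K u)
    {z : Euc k} (hz : z ∈ K) : 0 ≤ ⟪v, z - u⟫ + η * ⟪u - a, z - u⟫ := by
  -- Compare `u` with the point `u + s • (z - u)` of the segment, divide by `s`, and let `s` tend to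
  -- `0`.
  have key : ∀ s : ℝ, 0 < s → s ≤ 1 →
      0 ≤ ⟪v, z - u⟫ + η * ⟪u - a, z - u⟫ + s * (η / 2 * ‖z - u‖ ^ 2) := by
    intro s hs hs1
    have hmem : u + s • (z - u) ∈ K := hK.add_smul_sub_mem hu hz ⟨hs.le, hs1⟩
    have h := hmin hmem
    simp only [Set.mem_ofPred_eq] at h
    have e : u + s • (z - u) - a = (u - a) + s • (z - u) := by abel
    rw [e, norm_add_sq_real, inner_add_right, inner_smul_right, inner_smul_right, norm_smul,
      Real.norm_of_nonneg hs.le] at h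
    have h2 : 0 ≤ s * (⟪v, z - u⟫ + η * ⟪u - a, z - u⟫ + s * (η / 2 * ‖z - u‖ ^ 2)) := by
      nlinarith
    exact nonneg_of_mul_nonneg_right h2 hs
  have hlim : Filter.Tendsto
      (fun s : ℝ => ⟪v, z - u⟫ + η * ⟪u - a, z - u⟫ + s * (η / 2 * ‖z - u‖ ^ 2))
      (nhdsWithin 0 (Set.Ioi 0)) (nhds (⟪v, z - u⟫ + η * ⟪u - a, z - u⟫ + 0 * (η / 2 * ‖z - u‖ ^ 2))) :=
    (Continuous.tendsto (by fun_prop) 0).mono_left nhdsWithin_le_nhds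
  have := ge_of_tendsto hlim (by
    filter_upwards [Ioc_mem_nhdsGT (zero_lt_one (α := ℝ))] with s hs using key s hs.1 hs.2)
  simpa using this

/-- Three-point inequality of a proximal step. -/
theorem inner_sub_le_of_isMinOn_prox {K : Set (Euc k)} (hK : Convex ℝ K) {v a u : Euc k} {η : ℝ}
    (hu : u ∈ K) (hmin : IsMinOn (fun z : Euc k => ⟪v, z⟫ + η / 2 * ‖z - a‖ ^ 2) K u)
    {z : Euc k} (hz : z ∈ K) :
    ⟪v, u - z⟫ ≤ η / 2 * (‖z - a‖ ^ 2 - ‖z - u‖ ^ 2 - ‖u - a‖ ^ 2) := by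
  have h := inner_add_nonneg_of_isMinOn_prox hK hu hmin hz
  have e : z - a = (u - a) + (z - u) := by abel
  have e2 : ⟪v, u - z⟫ = -⟪v, z - u⟫ := by rw [← inner_neg_right, neg_sub]
  rw [e, norm_add_sq_real, e2]
  linarith

/-- A closed convex set has a nonexpansive metric projection. -/
theorem exists_convexProjection {K : Set (Euc k)} (hne : K.Nonempty) (hc : IsClosed K)
    (hK : Convex ℝ K) : ∃ p : Euc k → Euc k, Continuous p ∧
      ∀ b, ∀ u ∈ K, (∀ w ∈ K, ⟪b - u, w - u⟫ ≤ 0) → p b = u := by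
  have hex : ∀ b : Euc k, ∃ u ∈ K, ∀ w ∈ K, ⟪b - u, w - u⟫ ≤ 0 := by
    intro b
    obtain ⟨u, hu, h⟩ := exists_norm_eq_iInf_of_complete_convex hne hc.isComplete hK b
    exact ⟨u, hu, (norm_eq_iInf_iff_real_inner_le_zero hK hu).1 h⟩
  have hlip : ∀ b u b' u' : Euc k, u ∈ K → u' ∈ K → (∀ w ∈ K, ⟪b - u, w - u⟫ ≤ 0) →
      (∀ w ∈ K, ⟪b' - u', w - u'⟫ ≤ 0) → ‖u - u'‖ ≤ ‖b - b'‖ := by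
    intro b u b' u' hu hu' h h'
    have h1 := h u' hu'
    have h2 := h' u hu
    have h3 : ‖u - u'‖ ^ 2 ≤ ⟪b - b', u - u'⟫ := by
      rw [← real_inner_self_eq_norm_sq]
      simp only [inner_sub_left, inner_sub_right] at *
      linarith
    have h4 := real_inner_le_norm (b - b') (u - u')
    by_contra! hlt
    nlinarith [norm_nonneg (b - b'), norm_nonneg (u - u')]
  choose p hp1 hp2 using hex
  refine ⟨p, ?_, ?_⟩
  · refine (LipschitzWith.of_dist_le_mul (K := 1) fun b b' => ?_).continuous
    simpa [dist_eq_norm] using hlip b (p b) b' (p b') (hp1 b) (hp1 b') (hp2 b) (hp2 b')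
  · intro b u hu h
    have := hlip b (p b) b u (hp1 b) hu (hp2 b) h
    simpa [sub_eq_zero] using this

theorem convex_nonnegOrthant : Convex ℝ (nonnegOrthant k) := by
  intro a ha b hb s t hs ht _ j
  simpa using add_nonneg (mul_nonneg hs (ha j)) (mul_nonneg ht (hb j))

theorem zero_mem_nonnegOrthant : (0 : Euc k) ∈ nonnegOrthant k := fun j => by simp

theorem isClosed_nonnegOrthant : IsClosed (nonnegOrthant k) := by
  have : nonnegOrthant k = ⋂ j, {l : Euc k | 0 ≤ l j} := by
    ext l; simp [nonnegOrthant]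
  rw [this]
  exact isClosed_iInter fun j => isClosed_le continuous_const (by fun_prop)

theorem inner_euc (u v : Euc k) : ⟪u, v⟫ = ∑ j, u j * v j := by
  simp [PiLp.inner_apply, mul_comm]

theorem inner_nonneg_of_nonneg {u v : Euc k} (hu : u ∈ nonnegOrthant k) (hv : ∀ j, 0 ≤ v j) :
    0 ≤ ⟪u, v⟫ := by
  rw [inner_euc]
  exact Finset.sum_nonneg fun j _ => mul_nonneg (hu j) (hv j)

theorem sum_mul_le_norm_mul_l2Combine (u : Euc k) (c : Fin k → ℝ) :
    ∑ j, u j * c j ≤ ‖u‖ * l2Combine c := by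
  refine (Real.sum_mul_le_sqrt_mul_sqrt Finset.univ (fun j => u j) c).trans_eq ?_
  simp [EuclideanSpace.norm_eq, l2Combine]

end Geometry

theorem l2Combine_nonneg {m : ℕ} (c : Fin m → ℝ) : 0 ≤ l2Combine c := Real.sqrt_nonneg _

/-! ### Estimates for the linearized constraints. -/

namespace FCVI

variable {n m : ℕ} {P : FCVI n m} {L H Mg : ℝ} {Lc Hc : Fin m → ℝ}

theorem inner_gradT (P : FCVI n m) (u : Euc m) (x v : Euc n) :
    ⟪u, P.gradT x v⟫ = ⟪∑ j, u j • P.G j x, v⟫ := by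
  rw [inner_euc, sum_inner]
  simp [gradT, inner_smul_left]

theorem Standing.norm_sub_le_diamX (hP : P.Standing L H Mg Lc Hc) {x y : Euc n} (hx : x ∈ P.X)
    (hy : y ∈ P.X) : ‖x - y‖ ≤ P.diamX := by
  rw [← dist_eq_norm]
  exact Metric.dist_le_diam_of_mem hP.compact_X.isBounded hx hy

/-- Linearization at `x` plus the curvature bound dominates the constraint at `y`, after pairing
with a multiplier. -/
theorem Standing.inner_g_le (hP : P.Standing L H Mg Lc Hc) {u : Euc m} (hu : u ∈ nonnegOrthant m)
    {x y : Euc n} (hx : x ∈ P.X) (hy : y ∈ P.X) :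
    ⟪u, P.g y⟫ ≤ ⟪u, P.g x + P.gradT x (y - x)⟫
      + ‖u‖ * (l2Combine Lc / 2 * ‖y - x‖ ^ 2 + l2Combine Hc * ‖y - x‖) := by
  have h1 : ⟪u, P.g y⟫ - ⟪u, P.g x + P.gradT x (y - x)⟫
      ≤ (∑ j, u j * Lc j) * (‖y - x‖ ^ 2 / 2) + (∑ j, u j * Hc j) * ‖y - x‖ := by
    rw [inner_euc, inner_euc, ← Finset.sum_sub_distrib, Finset.sum_mul, Finset.sum_mul,
      ← Finset.sum_add_distrib]
    refine Finset.sum_le_sum fun j _ => ?_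
    have h := mul_le_mul_of_nonneg_left (hP.lipschitz_type_g j y hy x hx) (hu j)
    simp only [gradT, PiLp.add_apply]
    linarith
  have h2 := mul_le_mul_of_nonneg_right (sum_mul_le_norm_mul_l2Combine u Lc)
    (by positivity : 0 ≤ ‖y - x‖ ^ 2 / 2)
  have h3 := mul_le_mul_of_nonneg_right (sum_mul_le_norm_mul_l2Combine u Hc) (norm_nonneg (y - x))
  linarith

/-- The subgradient inequality from `x` to the feasible `z` gives `g_j(x) + ⟪G_j(x), z - x⟫ ≤ g_j(z)
≤ 0`. This trades the dual pairing of the linearization for the linear term of the primal step. -/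
theorem Standing.inner_lin_le (hP : P.Standing L H Mg Lc Hc) {u : Euc m} (hu : u ∈ nonnegOrthant m)
    {x y z : Euc n} (hx : x ∈ P.X) (hz : z ∈ P.feasible) :
    ⟪u, P.g x + P.gradT x (y - x)⟫ ≤ ⟪∑ j, u j • P.G j x, y - z⟫ := by
  rw [← inner_gradT, ← sub_nonneg, ← inner_sub_right]
  refine inner_nonneg_of_nonneg hu fun j => ?_
  have h := hP.subgradient_G j x hx z hz.1
  have h2 := hz.2 j
  simp only [gradT, PiLp.add_apply, PiLp.sub_apply]
  simp only [inner_sub_right] at *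
  linarith

/-- The change of the linearization along two consecutive steps. -/
theorem Standing.norm_lin_sub_le (hP : P.Standing L H Mg Lc Hc) {x : ℕ → Euc n} {t : ℕ}
    (hx : ∀ s ≤ t, x s ∈ P.X) :
    ‖P.lin x t - P.lin x (t - 1)‖
      ≤ Mg * ‖x t - x (t - 1)‖ + 2 * Mg * ‖x (t - 1) - x (t - 1 - 1)‖ := by
  have h1 := hP.lipschitz_g _ (hx (t - 1) (by omega)) _ (hx (t - 1 - 1) (by omega))
  have h2 := hP.bounded_G _ (hx (t - 1) (by omega)) (x t - x (t - 1))
  have h3 := hP.bounded_G _ (hx (t - 1 - 1) (by omega)) (x (t - 1) - x (t - 1 - 1))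
  have e : P.lin x t - P.lin x (t - 1) = P.gradT (x (t - 1)) (x t - x (t - 1))
      + (P.g (x (t - 1)) - P.g (x (t - 1 - 1)))
      - P.gradT (x (t - 1 - 1)) (x (t - 1) - x (t - 1 - 1)) := by
    simp only [lin]; abel
  rw [e]
  have h4 := norm_sub_le (P.gradT (x (t - 1)) (x t - x (t - 1))
      + (P.g (x (t - 1)) - P.g (x (t - 1 - 1))))
      (P.gradT (x (t - 1 - 1)) (x (t - 1) - x (t - 1 - 1)))
  have h5 := norm_add_le (P.gradT (x (t - 1)) (x t - x (t - 1)))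
      (P.g (x (t - 1)) - P.g (x (t - 1 - 1)))
  linarith

end FCVI

/-! ### The potential and its decrease in one iteration. -/

namespace FCVI

variable {n m : ℕ} {P : FCVI n m} {L H Mg : ℝ} {Lc Hc : Fin m → ℝ}

/-- Oracle noise along a trajectory. -/
def noise {Ξ : Type*} (P : FCVI n m) (Fr : Euc n → Ξ → Euc n) (x : ℕ → Euc n) (s : ℕ → Ξ)
    (t : ℕ) : Euc n :=
  Fr (x t) (s t) - P.F (x t)

/-- Potential function of StOpConEx relative to a reference pair `(z, u)`. -/
noncomputable def potential (P : FCVI n m) (L κ η τ : ℝ) (x : ℕ → Euc n) (l : ℕ → Euc m)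
    (e : ℕ → Euc n) (z : Euc n) (u : Euc m) (t : ℕ) : ℝ :=
  η / 2 * ‖z - x t‖ ^ 2 + τ / 2 * ‖u - l t‖ ^ 2 - ⟪P.F (x t) - P.F (x (t - 1)), x t - z⟫
    + ⟪l t - u, P.lin x t - P.lin x (t - 1)⟫ + ⟪e (t - 1), x t - z⟫
    + (3 / 4 * κ + L / 2) * ‖x t - x (t - 1)‖ ^ 2 + κ / 2 * ‖x (t - 1) - x (t - 1 - 1)‖ ^ 2

theorem IsStOpConExRun.mem_X {Ξ : Type*} {Fr : Euc n → Ξ → Euc n} {x0 : Euc n}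
    {θ η τ : ℕ → ℝ} {T : ℕ} {s : ℕ → Ξ} {x : ℕ → Euc n} {l : ℕ → Euc m}
    (h : P.IsStOpConExRun Fr x0 θ η τ T s x l) (hx0 : x0 ∈ P.X) {t : ℕ} (ht : t ≤ T) :
    x t ∈ P.X := by
  cases t with
  | zero => rw [h.init_x]; exact hx0
  | succ t => exact h.primal_mem t ht

theorem inner_le_of_sq_norm_le {k : ℕ} {a b : Euc k} {τ c : ℝ} (hτ : 0 < τ)
    (hb : ‖b‖ ^ 2 ≤ 2 * τ * c) : ⟪a, b⟫ ≤ τ / 2 * ‖a‖ ^ 2 + c := by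
  have h := real_inner_le_norm a b
  have h2 : 0 ≤ (τ * ‖a‖ - ‖b‖) ^ 2 := sq_nonneg _
  have h3 : 2 * τ * ⟪a, b⟫ ≤ 2 * τ * (τ / 2 * ‖a‖ ^ 2 + c) := by nlinarith
  exact le_of_mul_le_mul_left h3 (by positivity)

theorem Standing.sq_norm_lin_sub_le (hP : P.Standing L H Mg Lc Hc) {x : ℕ → Euc n} {t : ℕ}
    (hx : ∀ s ≤ t, x s ∈ P.X) {κ τ : ℝ} (hκ : 6 * Mg ^ 2 ≤ κ * τ) :
    ‖P.lin x t - P.lin x (t - 1)‖ ^ 2 ≤ 2 * τ * (κ / 4 * (‖x t - x (t - 1)‖ ^ 2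
      + 2 * ‖x (t - 1) - x (t - 1 - 1)‖ ^ 2)) := by
  have h := hP.norm_lin_sub_le hx
  set p := ‖x t - x (t - 1)‖
  set r := ‖x (t - 1) - x (t - 1 - 1)‖
  have h2 : ‖P.lin x t - P.lin x (t - 1)‖ ^ 2 ≤ (Mg * p + 2 * Mg * r) ^ 2 :=
    pow_le_pow_left₀ (norm_nonneg _) h 2
  -- Cauchy–Schwarz with `p + 2 r = 1 · p + √2 · (√2 r)`. The factor `3 Mg ^ 2` is half of the `6 Mg
  -- ^ 2` in `hκ`.
  have h3 : (Mg * p + 2 * Mg * r) ^ 2 ≤ 3 * Mg ^ 2 * (p ^ 2 + 2 * r ^ 2) := by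
    nlinarith [mul_nonneg (sq_nonneg Mg) (sq_nonneg (p - r))]
  have h4 := mul_le_mul_of_nonneg_right hκ (by positivity : 0 ≤ p ^ 2 + 2 * r ^ 2)
  linarith

/-- One iteration of StOpConEx decreases the potential. -/
theorem Standing.step_le (hP : P.Standing L H Mg Lc Hc) {Ξ : Type*} {Fr : Euc n → Ξ → Euc n}
    {x0 : Euc n} (hx0 : x0 ∈ P.X) {κ η τ : ℝ} {T : ℕ} {s : ℕ → Ξ} {x : ℕ → Euc n} {l : ℕ → Euc m}
    (h : P.IsStOpConExRun Fr x0 (fun _ => 1) (fun _ => η) (fun _ => τ) T s x l)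
    (hτ : 0 < τ) (hκ : 6 * Mg ^ 2 ≤ κ * τ) {z : Euc n} (hz : z ∈ P.feasible) {u : Euc m}
    (hu : u ∈ nonnegOrthant m) {t : ℕ} (ht : t < T) :
    ⟪P.F (x (t + 1)), x (t + 1) - z⟫ + ⟪u, P.g (x (t + 1))⟫
      ≤ P.potential L κ η τ x l (P.noise Fr x s) z u t
        - P.potential L κ η τ x l (P.noise Fr x s) z u (t + 1)
        - ⟪P.noise Fr x s t, x t - z⟫
        + ((H + ‖P.noise Fr x s t - P.noise Fr x s (t - 1)‖ + ‖u‖ * l2Combine Hc)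
              * ‖x (t + 1) - x t‖
          + (‖u‖ * l2Combine Lc / 2 + 3 / 4 * κ + L - η / 2) * ‖x (t + 1) - x t‖ ^ 2) := by
  have hxX : ∀ s ≤ t, x s ∈ P.X := fun s hs => h.mem_X hx0 (by omega)
  have hprimal := inner_sub_le_of_isMinOn_prox hP.convex_X (h.primal_mem t ht)
    (h.primal_min t ht) hz.1
  have hdual := inner_sub_le_of_isMinOn_prox convex_nonnegOrthant (h.dual_mem t ht)
    (h.dual_min t ht) hu
  have hg := hP.inner_g_le hu (hxX t le_rfl) (h.primal_mem t ht)
  have hl := hP.inner_lin_le (y := x (t + 1)) (h.dual_mem t ht) (hxX t le_rfl) hz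
  -- The dual proximal term pays for `τ / 2 * ‖l (t + 1) - l t‖ ^ 2`. Of the stored `3/4 κ` and `κ /
  -- 2`, this uses `κ / 4` and `κ / 2`; the remaining `κ / 2` on the latest step becomes the
  -- older-step term of the next potential.
  have hq := inner_le_of_sq_norm_le (a := l (t + 1) - l t) hτ (hP.sq_norm_lin_sub_le hxX hκ)
  have hY : -⟪P.noise Fr x s t - P.noise Fr x s (t - 1), x (t + 1) - x t⟫
      ≤ ‖P.noise Fr x s t - P.noise Fr x s (t - 1)‖ * ‖x (t + 1) - x t‖ :=
    (neg_le_abs _).trans (abs_real_inner_le_norm _ _)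
  have hF : -⟪P.F (x t) - P.F (x (t - 1)), x (t + 1) - x t⟫
      ≤ (L * ‖x t - x (t - 1)‖ + H) * ‖x (t + 1) - x t‖ :=
    ((neg_le_abs _).trans (abs_real_inner_le_norm _ _)).trans
      (mul_le_mul_of_nonneg_right
        (hP.lipschitz_F _ (hxX t le_rfl) _ (hxX (t - 1) (by omega))) (norm_nonneg _))
  -- Half of the product `L ‖x t - x (t - 1)‖ ‖x (t + 1) - x t‖` is charged to each square. The old
  -- square is in the potential at `t`; the new one, with the `L / 2` stored at `t + 1`, makes the
  -- `L` of the residual.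
  have hF2 : 0 ≤ L * (‖x t - x (t - 1)‖ - ‖x (t + 1) - x t‖) ^ 2 :=
    mul_nonneg hP.L_nonneg (sq_nonneg _)
  have elin : P.lin x (t + 1) = P.g (x t) + P.gradT (x t) (x (t + 1) - x t) := rfl
  rw [← elin] at hg hl
  have eFr : ∀ r, Fr (x r) (s r) = P.F (x r) + P.noise Fr x s r := fun r => by
    simp [noise]
  simp only [eFr] at hprimal
  set e := P.noise Fr x s
  simp only [potential, Nat.add_sub_cancel]
  -- Once the vectors are opaque, the claim is linear in their pairwise inner products, norms and
  -- the bounds above.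
  generalize P.lin x (t + 1) = a2 at *
  generalize P.lin x t = a1 at *
  generalize P.lin x (t - 1) = a0 at *
  generalize ∑ j, l (t + 1) j • P.G j (x t) = w at *
  generalize P.F (x (t + 1)) = f2 at *
  generalize P.F (x t) = f1 at *
  generalize P.F (x (t - 1)) = f0 at *
  rw [real_inner_comm] at hdual
  simp only [one_smul, inner_sub_left, inner_sub_right, inner_add_left, inner_add_right,
    inner_neg_right, add_smul] at *
  linarith

end FCVI

/-! ### Eliminating the step length by completing the square. -/

/-- Upper bound of `(h + Y) p - (N √T / D) p ^ 2` over `0 ≤ p ≤ D`, provided that `h = 0` when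
`N = 0`. -/
noncomputable def quadGain (N h D : ℝ) (T : ℕ) (Y : ℝ) : ℝ :=
  if N = 0 then Y * D else (h + Y) ^ 2 * D / (4 * N * √(T : ℝ))

theorem le_quadGain {N h D Y p : ℝ} {T : ℕ} (hT : 1 ≤ T) (hN : 0 ≤ N) (hNh : N = 0 → h = 0)
    (hD : 0 < D) (hY : 0 ≤ Y) (hpD : p ≤ D) :
    (h + Y) * p - N * √(T : ℝ) / D * p ^ 2 ≤ quadGain N h D T Y := by
  unfold quadGain
  split_ifs with h0
  · rw [h0, hNh h0]
    have := mul_le_mul_of_nonneg_left hpD hY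
    simpa using this
  · have hN' : 0 < N := lt_of_le_of_ne hN (Ne.symm h0)
    have hT' : 0 < √(T : ℝ) := Real.sqrt_pos.2 (by exact_mod_cast hT)
    have e : (h + Y) ^ 2 * D / (4 * N * √(T : ℝ)) - ((h + Y) * p - N * √(T : ℝ) / D * p ^ 2)
        = ((h + Y) * D - 2 * N * √(T : ℝ) * p) ^ 2 / (4 * N * √(T : ℝ) * D) := by
      field_simp
      ring
    have : 0 ≤ ((h + Y) * D - 2 * N * √(T : ℝ) * p) ^ 2 / (4 * N * √(T : ℝ) * D) := by positivity
    linarith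

theorem quadGain_le {N h D Y : ℝ} {T : ℕ} {a b : ℝ} (hN : 0 ≤ N) (hD : 0 < D) (hh : h = a + b) :
    quadGain N h D T Y ≤ (if N = 0 then D else 0) * Y
      + 3 * D / (4 * N * √(T : ℝ)) * (a ^ 2 + b ^ 2 + Y ^ 2) := by
  unfold quadGain
  split_ifs with h0
  · simp [h0, mul_comm]
  · have h1 : (h + Y) ^ 2 ≤ 3 * (a ^ 2 + b ^ 2 + Y ^ 2) := by
      subst hh
      nlinarith [sq_nonneg (a - b), sq_nonneg (a - Y), sq_nonneg (b - Y)]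
    have h2 : (h + Y) ^ 2 * D / (4 * N * √(T : ℝ))
        ≤ 3 * (a ^ 2 + b ^ 2 + Y ^ 2) * D / (4 * N * √(T : ℝ)) := by gcongr
    refine h2.trans_eq ?_
    ring

/-! ### Telescoping: the pathwise bound. -/

namespace FCVI

variable {n m : ℕ} {P : FCVI n m} {L H Mg : ℝ} {Lc Hc : Fin m → ℝ}

theorem potential_zero {κ η τ : ℝ} {x : ℕ → Euc n} {l : ℕ → Euc m} (hl : l 0 = 0)
    (e : ℕ → Euc n) (z : Euc n) (u : Euc m) :
    P.potential L κ η τ x l e z u 0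
      = η / 2 * ‖z - x 0‖ ^ 2 + τ / 2 * ‖u‖ ^ 2 + ⟪e 0, x 0 - z⟫ := by
  simp [potential, hl]

/-- The final potential is subtracted after telescoping, so a lower bound is needed. Its squares
absorb the cross terms; only the jump constant `H` and the last noise survive, each times the
diameter. -/
theorem Standing.potential_ge (hP : P.Standing L H Mg Lc Hc) {κ η τ : ℝ} {x : ℕ → Euc n} {t : ℕ}
    (hx : ∀ s ≤ t, x s ∈ P.X) (l : ℕ → Euc m) (e : ℕ → Euc n) {z : Euc n} (hz : z ∈ P.X)
    (u : Euc m) (hτ : 0 < τ) (hκ0 : 0 ≤ κ) (hκ : 6 * Mg ^ 2 ≤ κ * τ) (hη : 8 * L ≤ η) :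
    -(H * P.diamX + P.diamX * ‖e (t - 1)‖) ≤ P.potential L κ η τ x l e z u t := by
  have hq := inner_le_of_sq_norm_le (a := u - l t) hτ (hP.sq_norm_lin_sub_le hx hκ)
  have hF : ⟪P.F (x t) - P.F (x (t - 1)), x t - z⟫
      ≤ (L * ‖x t - x (t - 1)‖ + H) * ‖x t - z‖ :=
    (real_inner_le_norm _ _).trans
      (mul_le_mul_of_nonneg_right
        (hP.lipschitz_F _ (hx t le_rfl) _ (hx (t - 1) (by omega))) (norm_nonneg _))
  have he : -⟪e (t - 1), x t - z⟫ ≤ ‖e (t - 1)‖ * ‖x t - z‖ :=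
    (neg_le_abs _).trans (abs_real_inner_le_norm _ _)
  have hd := hP.norm_sub_le_diamX (hx t le_rfl) hz
  have h1 := mul_le_mul_of_nonneg_left hd (norm_nonneg (e (t - 1)))
  have h2 := mul_le_mul_of_nonneg_left hd hP.H_nonneg
  have h3 : 0 ≤ L * (‖x t - x (t - 1)‖ - ‖x t - z‖) ^ 2 := mul_nonneg hP.L_nonneg (sq_nonneg _)
  have h4 := mul_le_mul_of_nonneg_right hη (sq_nonneg ‖x t - z‖)
  have h5 : 0 ≤ L * ‖x t - z‖ ^ 2 := mul_nonneg hP.L_nonneg (sq_nonneg _)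
  have h6 : 0 ≤ κ * ‖x t - x (t - 1)‖ ^ 2 := mul_nonneg hκ0 (sq_nonneg _)
  have e1 : ⟪l t - u, P.lin x t - P.lin x (t - 1)⟫ = -⟪u - l t, P.lin x t - P.lin x (t - 1)⟫ := by
    rw [← inner_neg_left, neg_sub]
  have hp : P.potential L κ η τ x l e z u t = η / 2 * ‖x t - z‖ ^ 2 + τ / 2 * ‖u - l t‖ ^ 2
      - ⟪P.F (x t) - P.F (x (t - 1)), x t - z⟫
      - ⟪u - l t, P.lin x t - P.lin x (t - 1)⟫ + ⟪e (t - 1), x t - z⟫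
      + (3 / 4 * κ + L / 2) * ‖x t - x (t - 1)‖ ^ 2
      + κ / 2 * ‖x (t - 1) - x (t - 1 - 1)‖ ^ 2 := by
    rw [potential, e1, norm_sub_rev z]; ring
  rw [hp]
  nlinarith

/-- The pathwise bound on the accumulated saddle gap. -/
noncomputable def pathBound (P : FCVI n m) (H N h η τ ρ : ℝ) (T : ℕ) (x e : ℕ → Euc n) : ℝ :=
  η / 2 * P.diamX ^ 2 + τ / 2 * ρ ^ 2 + H * P.diamX + P.diamX * ‖e 0‖ + P.diamX * ‖e (T - 1)‖
    + P.diamX * ‖∑ t ∈ Finset.range T, e t‖ - ∑ t ∈ Finset.range T, ⟪e t, x t - x 0⟫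
    + ∑ t ∈ Finset.range T, quadGain N h P.diamX T ‖e t - e (t - 1)‖

theorem Standing.sum_le_pathBound (hP : P.Standing L H Mg Lc Hc) (hD : 0 < P.diamX)
    {Ξ : Type*} {Fr : Euc n → Ξ → Euc n}
    {x0 : Euc n} (hx0 : x0 ∈ P.X) {B σ : ℝ} (hB : 1 ≤ B) (hσ : 0 ≤ σ) {T : ℕ} (hT : 1 ≤ T)
    {s : ℕ → Ξ} {x : ℕ → Euc n} {l : ℕ → Euc m}
    (h : P.IsStOpConExRun Fr x0 (fun _ => 1)
      (fun _ => primalStep L (l2Combine Lc) Mg H (l2Combine Hc) σ P.diamX B T)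
      (fun _ => dualStep Mg P.diamX B) T s x l)
    {r : ℝ} (hr : H + l2Combine Hc * B + √3 * σ = 0 →
      calH (l2Combine Lc) (l2Combine Hc) P.diamX B r = 0)
    {z : Euc n} (hz : z ∈ P.feasible) {u : Euc m}
    (hu : u ∈ nonnegOrthant m) (hur : ‖u‖ ≤ r + 1) :
    ∑ t ∈ Finset.range T, (⟪P.F (x (t + 1)), x (t + 1) - z⟫ + ⟪u, P.g (x (t + 1))⟫)
      ≤ P.pathBound H (H + l2Combine Hc * B + √3 * σ)
        (H + calH (l2Combine Lc) (l2Combine Hc) P.diamX B r)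
        (primalStep L (l2Combine Lc) Mg H (l2Combine Hc) σ P.diamX B T)
        (dualStep Mg P.diamX B) (r + 1) T x (P.noise Fr x s) := by
  set D := P.diamX with hDdef
  set η := primalStep L (l2Combine Lc) Mg H (l2Combine Hc) σ D B T with hη
  set τ := dualStep Mg D B with hτdef
  set N := H + l2Combine Hc * B + √3 * σ with hNdef
  set e := P.noise Fr x s with he
  set c := calH (l2Combine Lc) (l2Combine Hc) D B r with hc
  have hMg := hP.Mg_pos
  have hB0 : 0 < B := by linarith
  have hL := hP.L_nonneg
  have hH := hP.H_nonneg
  have hLg := l2Combine_nonneg Lc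
  have hHg := l2Combine_nonneg Hc
  have hN : 0 ≤ N := by positivity
  have hτ : 0 < τ := by simp only [hτdef, dualStep]; positivity
  -- The value `κ = Mg B / D` gives `κ τ = 6 Mg ^ 2` exactly, and `η` contains `5 κ`, enough to
  -- cover the `3/4 κ` of the residual.
  have hκ0 : 0 ≤ Mg * B / D := by positivity
  have hκ : 6 * Mg ^ 2 ≤ Mg * B / D * τ := by
    refine le_of_eq ?_
    simp only [hτdef, dualStep]
    field_simp
  have hηe : η = l2Combine Lc * B + 8 * L + 5 * (Mg * B / D) + 2 * (N * √(T : ℝ) / D) := by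
    simp only [hη, primalStep, hNdef]; ring
  have hNT : 0 ≤ N * √(T : ℝ) / D := by positivity
  have hη8 : 8 * L ≤ η := by
    have : 0 ≤ l2Combine Lc * B := by positivity
    rw [hηe]; linarith
  have hxX : ∀ s ≤ T, x s ∈ P.X := fun s hs => h.mem_X hx0 hs
  -- When `N = 0` no negative quadratic term of weight `√T` remains, so the deterministic linear
  -- coefficient has to vanish.
  have hr0 : H + c = 0 ∨ N ≠ 0 := by
    by_cases h0 : N = 0
    · left
      have h1 : 0 ≤ l2Combine Hc * B := by positivity
      have h2 : 0 ≤ √3 * σ := by positivity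
      have h3 := hr h0
      have : H = 0 := by linarith
      rw [h3, this]; simp
    · right; exact h0
  have hstep : ∀ t ∈ Finset.range T,
      ⟪P.F (x (t + 1)), x (t + 1) - z⟫ + ⟪u, P.g (x (t + 1))⟫
      ≤ (P.potential L (Mg * B / D) η τ x l e z u t
        - P.potential L (Mg * B / D) η τ x l e z u (t + 1))
        - ⟪e t, x t - z⟫ + quadGain N (H + c) D T ‖e t - e (t - 1)‖ := by
    intro t ht
    rw [Finset.mem_range] at ht
    have h1 := hP.step_le hx0 h hτ hκ hz hu ht
    have hp := hP.norm_sub_le_diamX (hxX (t + 1) ht) (hxX t ht.le)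
    rw [← hDdef] at hp
    have h2 := le_quadGain (p := ‖x (t + 1) - x t‖) hT hN (fun h0 => hr0.resolve_right (not_not.2 h0)) hD
      (norm_nonneg (e t - e (t - 1))) hp
    set p := ‖x (t + 1) - x t‖
    have hp0 : 0 ≤ p := norm_nonneg _
    have h3 : ‖u‖ * l2Combine Hc * p ≤ l2Combine Hc * (r + 1) * p := by
      rw [mul_comm ‖u‖]; gcongr
    -- The step size covers curvature only for multipliers of norm up to `B`. The excess becomes
    -- linear in `p` through `p ≤ D`, which is the second summand of `calH`.
    have h4 : (‖u‖ - B) * p ^ 2 ≤ D * max (r + 1 - B) 0 * p := by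
      have : (‖u‖ - B) * p ^ 2 ≤ max (r + 1 - B) 0 * p ^ 2 := by
        gcongr
        exact le_max_of_le_left (by linarith)
      have h5 : p ^ 2 ≤ D * p := by nlinarith
      have := mul_le_mul_of_nonneg_left h5 (le_max_right (r + 1 - B) 0)
      linarith
    have h5 := mul_le_mul_of_nonneg_left h4 hLg
    have h6 : 0 ≤ Mg * B / D * p ^ 2 := by positivity
    have h7 : 0 ≤ L * p ^ 2 := by positivity
    have hce : c * p = l2Combine Hc * (r + 1) * p
        + l2Combine Lc * (D * max (r + 1 - B) 0 * p) / 2 := by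
      simp only [hc, calH]; ring
    have h8 : η * p ^ 2 = l2Combine Lc * B * p ^ 2 + 8 * (L * p ^ 2) + 5 * (Mg * B / D * p ^ 2)
        + 2 * (N * √(T : ℝ) / D * p ^ 2) := by rw [hηe]; ring
    nlinarith
  refine (Finset.sum_le_sum hstep).trans ?_
  rw [Finset.sum_add_distrib, Finset.sum_sub_distrib, Finset.sum_range_sub', potential_zero h.init_l]
  have hT' := hP.potential_ge (x := x) hxX l e hz.1 u hτ hκ0 hκ hη8
  -- Centering at `x 0` leaves `z` paired only with the total noise, which Cauchy–Schwarz bounds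
  -- uniformly in `z`; the other part will have mean zero.
  have hs : ∑ t ∈ Finset.range T, ⟪e t, x t - z⟫
      = ∑ t ∈ Finset.range T, ⟪e t, x t - x 0⟫ + ⟪∑ t ∈ Finset.range T, e t, x 0 - z⟫ := by
    rw [sum_inner, ← Finset.sum_add_distrib]
    refine Finset.sum_congr rfl fun t _ => ?_
    rw [← inner_add_right]; congr 1; abel
  have hd := hP.norm_sub_le_diamX (hxX 0 (by omega)) hz.1
  have hi : -⟪∑ t ∈ Finset.range T, e t, x 0 - z⟫ ≤ D * ‖∑ t ∈ Finset.range T, e t‖ := by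
    refine ((neg_le_abs _).trans (abs_real_inner_le_norm _ _)).trans ?_
    rw [mul_comm]; gcongr
  have hi0 : ⟪e 0, x 0 - z⟫ ≤ D * ‖e 0‖ := by
    refine (real_inner_le_norm _ _).trans ?_
    rw [mul_comm]; gcongr
  have h1 : η / 2 * ‖z - x 0‖ ^ 2 ≤ η / 2 * D ^ 2 := by
    rw [norm_sub_rev]
    have : 0 ≤ η := by linarith
    gcongr
  have h2 : τ / 2 * ‖u‖ ^ 2 ≤ τ / 2 * (r + 1) ^ 2 := by gcongr
  rw [hs, pathBound]
  linarith

end FCVI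

/-! ### Adaptedness of the iterates. -/

section Measurability

variable {n m k : ℕ}

/-- The minimizer is the projection of `a - η⁻¹ v` onto `K`, a continuous function of measurable
data. Measurability of the iterates is thus derived rather than assumed. -/
theorem measurable_of_isMinOn_prox {Ω : Type*} {mΩ : MeasurableSpace Ω} {K : Set (Euc k)}
    (hne : K.Nonempty) (hc : IsClosed K) (hK : Convex ℝ K) {v a u : Ω → Euc k}
    (hv : Measurable v) (ha : Measurable a) {η : ℝ} (hη : 0 < η) (hu : ∀ ω, u ω ∈ K)
    (hmin : ∀ ω, IsMinOn (fun z : Euc k => ⟪v ω, z⟫ + η / 2 * ‖z - a ω‖ ^ 2) K (u ω)) :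
    Measurable u := by
  obtain ⟨p, hp, hpu⟩ := exists_convexProjection hne hc hK
  have e : u = fun ω => p (a ω - η⁻¹ • v ω) := by
    funext ω
    refine (hpu _ _ (hu ω) fun w hw => ?_).symm
    have h := inner_add_nonneg_of_isMinOn_prox hK (hu ω) (hmin ω) hw
    have e1 : a ω - η⁻¹ • v ω - u ω = -(η⁻¹ • (v ω + η • (u ω - a ω))) := by
      rw [smul_add, smul_smul, inv_mul_cancel₀ hη.ne', one_smul]; abel
    rw [e1, inner_neg_left, real_inner_smul_left, inner_add_left, real_inner_smul_left]
    have := mul_nonneg (inv_nonneg.2 hη.le) h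
    linarith
  rw [e]
  exact hp.measurable.comp (ha.sub (hv.fun_const_smul _))

theorem measurable_comp_of_continuousOn {Ω : Type*} {mΩ : MeasurableSpace Ω} {K : Set (Euc k)}
    (hc : IsClosed K) {f : Euc k → Euc n} (hf : ContinuousOn f K) {x : Ω → Euc k}
    (hx : Measurable x) (hxK : ∀ ω, x ω ∈ K) : Measurable fun ω => f (x ω) := by
  classical
  have h : Measurable (K.piecewise f fun _ => 0) :=
    hf.measurable_piecewise continuousOn_const hc.measurableSet
  have e : (fun ω => f (x ω)) = fun ω => K.piecewise f (fun _ => 0) (x ω) := by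
    funext ω; rw [Set.piecewise_eq_of_mem _ _ _ (hxK ω)]
  rw [e]
  exact h.comp hx

theorem measurable_toLp {Ω : Type*} {mΩ : MeasurableSpace Ω} {f : Ω → Fin k → ℝ}
    (hf : ∀ j, Measurable fun ω => f ω j) : Measurable fun ω => (WithLp.toLp 2 (f ω) : Euc k) :=
  (PiLp.continuous_toLp 2 _).measurable.comp (measurable_pi_iff.2 hf)

namespace FCVI

variable {P : FCVI n m} {L H Mg : ℝ} {Lc Hc : Fin m → ℝ}

theorem Standing.measurable_lin (hP : P.Standing L H Mg Lc Hc) {Ω : Type*}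
    {mΩ : MeasurableSpace Ω} {x : ℕ → Ω → Euc n} {t : ℕ} (hx : ∀ s ≤ t, Measurable (x s))
    (hX : ∀ s ≤ t, ∀ ω, x s ω ∈ P.X) : Measurable fun ω => P.lin (fun s => x s ω) t := by
  have h1 := hx t le_rfl
  have h2 := hx (t - 1) (by omega)
  refine (measurable_comp_of_continuousOn hP.compact_X.isClosed hP.continuous_g h2
    (hX (t - 1) (by omega))).add (measurable_toLp fun j => ?_)
  exact ((hP.measurable_G j).comp h2).inner (h1.sub h2)

theorem Standing.measurable_dualDirection (hP : P.Standing L H Mg Lc Hc) {Ω : Type*}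
    {mΩ : MeasurableSpace Ω} {x : ℕ → Ω → Euc n} {t : ℕ} (hx : ∀ s ≤ t, Measurable (x s))
    (hX : ∀ s ≤ t, ∀ ω, x s ω ∈ P.X) :
    Measurable fun ω => -((1 + (1 : ℝ)) • P.lin (fun s => x s ω) t
      - (1 : ℝ) • P.lin (fun s => x s ω) (t - 1)) :=
  (((hP.measurable_lin hx hX).fun_const_smul _).sub ((hP.measurable_lin (t := t - 1)
    (fun s hs => hx s (by omega)) (fun s hs => hX s (by omega))).fun_const_smul _)).neg

theorem Standing.measurable_primalDirection (hP : P.Standing L H Mg Lc Hc) {Ω : Type*}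
    {mΩ : MeasurableSpace Ω} {a b x : Ω → Euc n} {l : Ω → Euc m} (ha : Measurable a)
    (hb : Measurable b) (hx : Measurable x) (hl : Measurable l) :
    Measurable fun ω => (1 + (1 : ℝ)) • a ω - (1 : ℝ) • b ω + ∑ j, l ω j • P.G j (x ω) := by
  refine ((ha.fun_const_smul _).sub (hb.fun_const_smul _)).add
    (Finset.measurable_fun_sum _ fun j _ => ?_)
  exact ((EuclideanSpace.proj j : Euc m →L[ℝ] ℝ).continuous.measurable.comp hl).smul
    ((hP.measurable_G j).comp hx)

/-- The `σ`-algebra generated by the first `t` samples. -/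
@[reducible]
def past {Ω Ξ : Type*} [MeasurableSpace Ξ] (ξ : ℕ → Ω → Ξ) (t : ℕ) : MeasurableSpace Ω :=
  ⨆ s ∈ Set.Iio t, MeasurableSpace.comap (ξ s) inferInstance

theorem past_mono {Ω Ξ : Type*} [MeasurableSpace Ξ] (ξ : ℕ → Ω → Ξ) {s t : ℕ} (h : s ≤ t) :
    past ξ s ≤ past ξ t :=
  biSup_mono fun _ hr => lt_of_lt_of_le hr h

theorem past_le {Ω Ξ : Type*} [MeasurableSpace Ξ] {mΩ : MeasurableSpace Ω} {ξ : ℕ → Ω → Ξ}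
    (hξ : ∀ t, Measurable (ξ t)) (t : ℕ) : past ξ t ≤ mΩ :=
  iSup₂_le fun s _ => (hξ s).comap_le

theorem measurable_past {Ω Ξ : Type*} [MeasurableSpace Ξ] (ξ : ℕ → Ω → Ξ) {s t : ℕ} (h : s < t) :
    Measurable[past ξ t] (ξ s) :=
  measurable_iff_comap_le.2
    (le_iSup₂_of_le (f := fun s (_ : s ∈ Set.Iio t) => MeasurableSpace.comap (ξ s) inferInstance)
      s h le_rfl)

/-- The iterate of index `t` depends only on samples of index below `t`, hence is independent of the
sample it is evaluated with. The induction is strong because an iteration looks back several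
iterates. -/
theorem Standing.measurable_run (hP : P.Standing L H Mg Lc Hc) {Ω Ξ : Type*} [MeasurableSpace Ξ]
    {ξ : ℕ → Ω → Ξ} {Fr : Euc n → Ξ → Euc n} (hFr : Measurable fun p : Euc n × Ξ => Fr p.1 p.2)
    {x0 : Euc n} (hx0 : x0 ∈ P.X) {η τ : ℝ} (hη : 0 < η) (hτ : 0 < τ) {T : ℕ}
    {x : ℕ → Ω → Euc n} {l : ℕ → Ω → Euc m}
    (hrun : ∀ ω, P.IsStOpConExRun Fr x0 (fun _ => 1) (fun _ => η) (fun _ => τ) T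
      (fun t => ξ t ω) (fun t => x t ω) (fun t => l t ω)) {t : ℕ} (ht : t ≤ T) :
    Measurable[past ξ t] (x t) ∧ Measurable[past ξ t] (l t) := by
  induction t using Nat.strong_induction_on with
  | _ t ih =>
  cases t with
  | zero =>
    have e1 : x 0 = fun _ => x0 := funext fun ω => (hrun ω).init_x
    have e2 : l 0 = fun _ => 0 := funext fun ω => (hrun ω).init_l
    rw [e1, e2]
    exact ⟨measurable_const, measurable_const⟩
  | succ t =>
    have hx : ∀ s ≤ t, Measurable[past ξ (t + 1)] (x s) := fun s hs =>
      (ih s (by omega) (by omega)).1.mono (past_mono ξ (by omega)) le_rfl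
    have hl : Measurable[past ξ (t + 1)] (l t) :=
      (ih t (by omega) (by omega)).2.mono (past_mono ξ (by omega)) le_rfl
    have hX : ∀ s ≤ t, ∀ ω, x s ω ∈ P.X := fun s hs ω => (hrun ω).mem_X hx0 (by omega)
    have hF : ∀ s ≤ t, Measurable[past ξ (t + 1)] fun ω => Fr (x s ω) (ξ s ω) := fun s hs =>
      hFr.comp ((hx s hs).prodMk (measurable_past ξ (by omega)))
    have hl' : Measurable[past ξ (t + 1)] (l (t + 1)) :=
      measurable_of_isMinOn_prox (mΩ := past ξ (t + 1)) ⟨0, zero_mem_nonnegOrthant⟩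
        isClosed_nonnegOrthant convex_nonnegOrthant
        (hP.measurable_dualDirection (mΩ := past ξ (t + 1)) hx hX) hl hτ
        (fun ω => (hrun ω).dual_mem t (by omega)) (fun ω => (hrun ω).dual_min t (by omega))
    exact ⟨measurable_of_isMinOn_prox (mΩ := past ξ (t + 1)) ⟨x0, hx0⟩ hP.compact_X.isClosed
        hP.convex_X (hP.measurable_primalDirection (mΩ := past ξ (t + 1)) (hF t le_rfl)
          (hF (t - 1) (by omega)) (hx t le_rfl) hl') (hx t le_rfl) hη
        (fun ω => (hrun ω).primal_mem t (by omega)) (fun ω => (hrun ω).primal_min t (by omega)),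
      hl'⟩

end FCVI

end Measurability

/-! ### Moments of the oracle noise at a random point. -/

section Noise

variable {n m : ℕ}

theorem integrable_sq_and_integral_le {Ω : Type*} {mΩ : MeasurableSpace Ω} {μ : Measure Ω}
    {f : Ω → Euc n} (hf : Measurable f) {c : ℝ} (hc : 0 ≤ c)
    (h : ∫⁻ ω, ‖f ω‖ₑ ^ 2 ∂μ ≤ ENNReal.ofReal c) :
    MemLp f 2 μ ∧ ∫ ω, ‖f ω‖ ^ 2 ∂μ ≤ c := by
  have e : ∀ ω, ENNReal.ofReal (‖f ω‖ ^ 2) = ‖f ω‖ₑ ^ 2 := fun ω => by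
    rw [ENNReal.ofReal_pow (norm_nonneg _), ofReal_norm]
  constructor
  · rw [memLp_two_iff_integrable_sq_norm hf.aestronglyMeasurable]
    refine ⟨(hf.norm.pow_const 2).aestronglyMeasurable, ?_⟩
    rw [hasFiniteIntegral_iff_ofReal (Filter.Eventually.of_forall fun ω => sq_nonneg _)]
    simp_rw [e]
    exact h.trans_lt ENNReal.ofReal_lt_top
  · rw [integral_eq_lintegral_of_nonneg_ae (Filter.Eventually.of_forall fun ω => sq_nonneg _)
      (hf.norm.pow_const 2).aestronglyMeasurable]
    simp_rw [e]
    exact ENNReal.toReal_le_of_le_ofReal hc h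

/-- Cauchy–Schwarz for the first moment. -/
theorem integral_norm_le_of_sq {Ω : Type*} {mΩ : MeasurableSpace Ω} {μ : Measure Ω}
    [IsProbabilityMeasure μ] {f : Ω → Euc n} (hf : MemLp f 2 μ) {c : ℝ} (hc : 0 ≤ c)
    (h : ∫ ω, ‖f ω‖ ^ 2 ∂μ ≤ c ^ 2) : ∫ ω, ‖f ω‖ ∂μ ≤ c := by
  have h1 : (∫ ω, ‖f ω‖ ∂μ) ^ 2 ≤ ∫ ω, ‖f ω‖ ^ 2 ∂μ := by
    have h2 := variance_nonneg (fun ω => ‖f ω‖) μ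
    rw [variance_eq_sub hf.norm] at h2
    simpa using h2
  exact (le_abs_self _).trans (abs_le_of_sq_le_sq (h1.trans h) hc)

namespace FCVI

theorem indepFun_past {Ω Ξ A : Type*} [MeasurableSpace Ξ] [MeasurableSpace A]
    {mΩ : MeasurableSpace Ω} {μ : Measure Ω} {ξ : ℕ → Ω → Ξ} (hξ : ∀ t, Measurable (ξ t))
    (hi : iIndepFun ξ μ) {t : ℕ} {U : Ω → A} (hU : Measurable[past ξ t] U) :
    IndepFun U (ξ t) μ := by
  have h := indep_iSup_of_disjoint (fun s => (hξ s).comap_le) hi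
    (S := Set.Iio t) (T := {t}) (by simp)
  rw [IndepFun_iff_Indep]
  refine indep_of_indep_of_le_left (indep_of_indep_of_le_right h ?_) hU.comap_le
  simp

variable {P : FCVI n m} {Ω Ξ : Type*} [MeasurableSpace Ξ] {ν : Measure Ξ}
  {Fr : Euc n → Ξ → Euc n} {σ : ℝ}

theorem IsOracle.measurable_mean [SFinite ν] (h : P.IsOracle ν Fr σ) :
    Measurable fun x => ∫ s, Fr x s ∂ν :=
  (h.measurable.stronglyMeasurable.integral_prod_right').measurable

/-- `F` carries no measurability hypothesis; on `X` it equals the oracle mean, a parametric integral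
of a jointly measurable function. -/
theorem IsOracle.measurable_F_comp [SFinite ν] (h : P.IsOracle ν Fr σ) {mΩ : MeasurableSpace Ω}
    {x : Ω → Euc n} (hx : Measurable x) (hX : ∀ ω, x ω ∈ P.X) :
    Measurable fun ω => P.F (x ω) := by
  have e : (fun ω => P.F (x ω)) = fun ω => ∫ s, Fr (x ω) s ∂ν :=
    funext fun ω => (h.unbiased _ (hX ω)).symm
  rw [e]
  exact h.measurable_mean.comp hx

/-- By independence the joint law is a product, so Tonelli freezes the point and the pointwise
variance bound applies. -/
theorem IsOracle.lintegral_noise_le [IsProbabilityMeasure ν] (h : P.IsOracle ν Fr σ)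
    {mΩ : MeasurableSpace Ω} {μ : Measure Ω} [IsProbabilityMeasure μ] {x : Ω → Euc n} {V : Ω → Ξ}
    (hXm : MeasurableSet P.X) (hx : Measurable x) (hX : ∀ ω, x ω ∈ P.X) (hV : Measurable V)
    (hlaw : μ.map V = ν) (hind : IndepFun x V μ) :
    ∫⁻ ω, ‖Fr (x ω) (V ω) - P.F (x ω)‖ₑ ^ 2 ∂μ ≤ ENNReal.ofReal (σ ^ 2) := by
  have hm : Measurable fun p : Euc n × Ξ => ‖Fr p.1 p.2 - ∫ s, Fr p.1 s ∂ν‖ₑ ^ 2 :=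
    ((h.measurable.sub (h.measurable_mean.comp measurable_fst)).enorm).pow_const 2
  have hp := hind.map_prod_eq_prod_map_map hx.aemeasurable hV.aemeasurable
  rw [hlaw] at hp
  have := Measure.isProbabilityMeasure_map (μ := μ) hx.aemeasurable
  calc ∫⁻ ω, ‖Fr (x ω) (V ω) - P.F (x ω)‖ₑ ^ 2 ∂μ
      = ∫⁻ ω, ‖Fr (x ω) (V ω) - ∫ s, Fr (x ω) s ∂ν‖ₑ ^ 2 ∂μ := by
        simp_rw [h.unbiased _ (hX _)]
    _ = ∫⁻ p, ‖Fr p.1 p.2 - ∫ s, Fr p.1 s ∂ν‖ₑ ^ 2 ∂((μ.map x).prod ν) := by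
        rw [← hp, lintegral_map hm (hx.prodMk hV)]
    _ = ∫⁻ z, ∫⁻ s, ‖Fr z s - ∫ s, Fr z s ∂ν‖ₑ ^ 2 ∂ν ∂(μ.map x) :=
        lintegral_prod _ hm.aemeasurable
    _ ≤ ∫⁻ _, ENNReal.ofReal (σ ^ 2) ∂(μ.map x) := by
        refine lintegral_mono_ae ?_
        have hae : ∀ᵐ z ∂(μ.map x), z ∈ P.X :=
          (ae_map_iff hx.aemeasurable hXm).2 (Filter.Eventually.of_forall hX)
        filter_upwards [hae] with z hz
        rw [h.unbiased z hz]
        exact h.variance_le z hz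
    _ = ENNReal.ofReal (σ ^ 2) := by simp

/-- The same freezing applied to the pair `(x, Z)`: the inner integral over the sample vanishes by
unbiasedness. -/
theorem IsOracle.integral_inner_noise_eq_zero [IsProbabilityMeasure ν] (h : P.IsOracle ν Fr σ)
    {mΩ : MeasurableSpace Ω} {μ : Measure Ω} [IsProbabilityMeasure μ] {x Z : Ω → Euc n}
    {V : Ω → Ξ} (hXm : MeasurableSet P.X) (hx : Measurable x) (hX : ∀ ω, x ω ∈ P.X)
    (hZ : Measurable Z) (hV : Measurable V) (hlaw : μ.map V = ν)
    (hind : IndepFun (fun ω => (x ω, Z ω)) V μ)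
    (hint : Integrable (fun ω => ⟪Fr (x ω) (V ω) - P.F (x ω), Z ω⟫) μ) :
    ∫ ω, ⟪Fr (x ω) (V ω) - P.F (x ω), Z ω⟫ ∂μ = 0 := by
  have hm : Measurable fun p : (Euc n × Euc n) × Ξ =>
      ⟪Fr p.1.1 p.2 - ∫ s, Fr p.1.1 s ∂ν, p.1.2⟫ :=
    ((h.measurable.comp (by fun_prop : Measurable fun p : (Euc n × Euc n) × Ξ => (p.1.1, p.2))).sub
      (h.measurable_mean.comp (by fun_prop))).inner (by fun_prop)
  have hU : Measurable fun ω => (x ω, Z ω) := hx.prodMk hZ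
  have hp := hind.map_prod_eq_prod_map_map hU.aemeasurable hV.aemeasurable
  rw [hlaw] at hp
  have := Measure.isProbabilityMeasure_map (μ := μ) hU.aemeasurable
  have e : (fun ω => ⟪Fr (x ω) (V ω) - P.F (x ω), Z ω⟫)
      = fun ω => ⟪Fr (x ω) (V ω) - ∫ s, Fr (x ω) s ∂ν, Z ω⟫ := by
    funext ω; rw [h.unbiased _ (hX _)]
  rw [e] at hint ⊢
  have hint' : Integrable (fun p : (Euc n × Euc n) × Ξ =>
      ⟪Fr p.1.1 p.2 - ∫ s, Fr p.1.1 s ∂ν, p.1.2⟫) ((μ.map fun ω => (x ω, Z ω)).prod ν) := by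
    rw [← hp, integrable_map_measure hm.aestronglyMeasurable (hU.prodMk hV).aemeasurable]
    exact hint
  calc ∫ ω, ⟪Fr (x ω) (V ω) - ∫ s, Fr (x ω) s ∂ν, Z ω⟫ ∂μ
      = ∫ p, ⟪Fr p.1.1 p.2 - ∫ s, Fr p.1.1 s ∂ν, p.1.2⟫
          ∂((μ.map fun ω => (x ω, Z ω)).prod ν) := by
        rw [← hp, integral_map (hU.prodMk hV).aemeasurable hm.aestronglyMeasurable]
    _ = ∫ q, ∫ s, ⟪Fr q.1 s - ∫ s, Fr q.1 s ∂ν, q.2⟫ ∂ν ∂(μ.map fun ω => (x ω, Z ω)) :=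
        integral_prod _ hint'
    _ = ∫ _, 0 ∂(μ.map fun ω => (x ω, Z ω)) := by
        refine integral_congr_ae ?_
        have hae : ∀ᵐ q ∂(μ.map fun ω => (x ω, Z ω)), q.1 ∈ P.X :=
          (ae_map_iff hU.aemeasurable (measurable_fst hXm)).2 (Filter.Eventually.of_forall hX)
        filter_upwards [hae] with q hq
        have hi := h.integrable q.1 hq
        have h2 := integral_inner (𝕜 := ℝ) (hi.sub (integrable_const (∫ s, Fr q.1 s ∂ν))) q.2
        simp only [Pi.sub_apply] at h2
        simp_rw [real_inner_comm q.2]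
        rw [h2, integral_sub hi (integrable_const _)]
        simp
    _ = 0 := by simp

end FCVI

end Noise

/-! ### Square integrable martingale differences. -/

section MartingaleDifference

variable {n : ℕ} {Ω : Type*} {mΩ : MeasurableSpace Ω} {μ : Measure Ω}

/-- A square integrable martingale difference sequence of length `T` with variances at most
`σ ^ 2`, adapted to `𝒢` shifted by one. -/
structure IsMartingaleDifference (μ : Measure Ω) (𝒢 : ℕ → MeasurableSpace Ω) (σ : ℝ) (T : ℕ)
    (e : ℕ → Ω → Euc n) : Prop where
  mono : Monotone 𝒢
  le : ∀ t, 𝒢 t ≤ mΩ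
  measurable : ∀ t < T, Measurable[𝒢 (t + 1)] (e t)
  memLp : ∀ t < T, MemLp (e t) 2 μ
  integral_sq_le : ∀ t < T, ∫ ω, ‖e t ω‖ ^ 2 ∂μ ≤ σ ^ 2
  orthogonal : ∀ t < T, ∀ Z : Ω → Euc n, Measurable[𝒢 t] Z → MemLp Z 2 μ →
    ∫ ω, ⟪e t ω, Z ω⟫ ∂μ = 0

theorem integrable_inner_of_memLp {f g : Ω → Euc n} (hf : MemLp f 2 μ) (hg : MemLp g 2 μ) :
    Integrable (fun ω => ⟪f ω, g ω⟫) μ := by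
  refine Integrable.mono' (hf.norm.integrable_mul hg.norm)
    (hf.aestronglyMeasurable.inner hg.aestronglyMeasurable)
    (Filter.Eventually.of_forall fun ω => ?_)
  simpa using norm_inner_le_norm (𝕜 := ℝ) (f ω) (g ω)

theorem integral_sq_norm_add {f g : Ω → Euc n} (hf : MemLp f 2 μ) (hg : MemLp g 2 μ) :
    ∫ ω, ‖f ω + g ω‖ ^ 2 ∂μ
      = ∫ ω, ‖f ω‖ ^ 2 ∂μ + 2 * ∫ ω, ⟪f ω, g ω⟫ ∂μ + ∫ ω, ‖g ω‖ ^ 2 ∂μ := by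
  have h1 := hf.norm.integrable_sq
  have h2 := hg.norm.integrable_sq
  have h3 := (integrable_inner_of_memLp hf hg).const_mul 2
  have h4 : Integrable (fun ω => ‖f ω‖ ^ 2 + 2 * ⟪f ω, g ω⟫) μ := h1.add h3
  simp_rw [norm_add_sq_real]
  rw [integral_add h4 h2, integral_add h1 h3, integral_const_mul]

namespace IsMartingaleDifference

variable {𝒢 : ℕ → MeasurableSpace Ω} {σ : ℝ} {T : ℕ} {e : ℕ → Ω → Euc n}

theorem memLp_sum (h : IsMartingaleDifference μ 𝒢 σ T e) {k : ℕ} (hk : k ≤ T) :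
    MemLp (fun ω => ∑ t ∈ Finset.range k, e t ω) 2 μ :=
  memLp_finsetSum _ fun t ht => h.memLp t (by rw [Finset.mem_range] at ht; omega)

theorem integral_sq_sum_le (h : IsMartingaleDifference μ 𝒢 σ T e) {k : ℕ} (hk : k ≤ T) :
    ∫ ω, ‖∑ t ∈ Finset.range k, e t ω‖ ^ 2 ∂μ ≤ k * σ ^ 2 := by
  induction k with
  | zero => simp
  | succ k ih =>
    have hm : Measurable[𝒢 k] fun ω => ∑ t ∈ Finset.range k, e t ω :=
      Finset.measurable_fun_sum _ fun t ht => by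
        rw [Finset.mem_range] at ht
        exact (h.measurable t (by omega)).mono (h.mono (by omega)) le_rfl
    have h0 := h.orthogonal k (by omega) _ hm (h.memLp_sum (by omega))
    simp_rw [Finset.sum_range_succ]
    rw [integral_sq_norm_add (h.memLp_sum (by omega)) (h.memLp k (by omega))]
    simp_rw [real_inner_comm (e k _)] at *
    rw [h0]
    have h1 := ih (by omega)
    have h2 := h.integral_sq_le k (by omega)
    push_cast
    linarith

theorem memLp_sub (h : IsMartingaleDifference μ 𝒢 σ T e) {t : ℕ} (ht : t < T) :
    MemLp (fun ω => e t ω - e (t - 1) ω) 2 μ :=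
  (h.memLp t ht).sub (h.memLp (t - 1) (by omega))

theorem integral_sq_sub_le (h : IsMartingaleDifference μ 𝒢 σ T e) {t : ℕ} (ht : t < T) :
    ∫ ω, ‖e t ω - e (t - 1) ω‖ ^ 2 ∂μ ≤ 2 * σ ^ 2 := by
  cases t with
  -- Here `0 - 1 = 0`, so the increment is zero, matching the convention that the oracle value at
  -- `-1` equals that at `0`.
  | zero => simp; positivity
  | succ t =>
    have h0 := h.orthogonal (t + 1) ht _ (h.measurable t (by omega)).neg (h.memLp t (by omega)).neg
    have h1 := integral_sq_norm_add (h.memLp (t + 1) ht) (h.memLp t (by omega)).neg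
    have h2 := h.integral_sq_le (t + 1) ht
    have h3 := h.integral_sq_le t (by omega)
    simp only [Pi.neg_apply, norm_neg, ← sub_eq_add_neg, Nat.add_sub_cancel] at *
    rw [h1, h0]
    linarith

end IsMartingaleDifference

end MartingaleDifference

/-! ### Expectation of the pathwise bound. -/

section Expectation

variable {n m : ℕ} {P : FCVI n m} {Ω : Type*} {mΩ : MeasurableSpace Ω} {μ : Measure Ω}
  [IsProbabilityMeasure μ] {𝒢 : ℕ → MeasurableSpace Ω} {σ : ℝ} {T : ℕ} {e x : ℕ → Ω → Euc n}

theorem integrable_quadGain {Y : Ω → ℝ} (hY : MemLp Y 2 μ) (N h D : ℝ) :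
    Integrable (fun ω => quadGain N h D T (Y ω)) μ := by
  unfold quadGain
  split_ifs
  · exact (hY.integrable one_le_two).mul_const D
  · exact ((((memLp_const h).add hY).integrable_sq).mul_const D).div_const _

theorem IsMartingaleDifference.integral_quadGain_le (h : IsMartingaleDifference μ 𝒢 σ T e)
    (hT : 1 ≤ T) (hσ : 0 ≤ σ) {H c D N : ℝ} (hH : 0 ≤ H) (hD : 0 < D) (hN : H + √3 * σ ≤ N)
    {t : ℕ} (ht : t < T) :
    ∫ ω, quadGain N (H + c) D T ‖e t ω - e (t - 1) ω‖ ∂μ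
      ≤ D / √(T : ℝ) * (3 / 4 * H + 3 / 4 * (c ^ 2 / N) + √3 / 2 * σ) := by
  have h3 : (0 : ℝ) < √3 := by positivity
  have h33 : √3 * √3 = (3 : ℝ) := Real.mul_self_sqrt (by norm_num)
  have hT' : 0 < √(T : ℝ) := Real.sqrt_pos.2 (by exact_mod_cast hT)
  have hσ3 : 0 ≤ √3 * σ := by positivity
  have hN0 : 0 ≤ N := by linarith
  have hmem := h.memLp_sub ht
  have hsq := h.integral_sq_sub_le ht
  have hY1 : Integrable (fun ω => ‖e t ω - e (t - 1) ω‖) μ := hmem.norm.integrable one_le_two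
  have hY2 : Integrable (fun ω => ‖e t ω - e (t - 1) ω‖ ^ 2) μ := hmem.norm.integrable_sq
  have hb := integral_norm_le_of_sq hmem (c := √2 * σ) (by positivity)
    (by rw [mul_pow, Real.sq_sqrt (by norm_num)]; exact hsq)
  rcases hN0.eq_or_lt with h0 | h0
  -- For `N = 0` both `σ` and `H` vanish, so the noise increment has mean norm zero, and `c ^ 2 / N`
  -- reads as `0`.
  · have hs : σ = 0 := by
      have : √3 * σ = 0 := by linarith
      exact (mul_eq_zero.1 this).resolve_left h3.ne'
    have hH0 : H = 0 := by linarith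
    subst hs hH0
    simp only [quadGain, ← h0, if_true, integral_mul_const]
    have : (∫ ω, ‖e t ω - e (t - 1) ω‖ ∂μ) * D ≤ √2 * 0 * D := by gcongr
    simpa using this
  · have hI : Integrable (fun ω => 3 * D / (4 * N * √(T : ℝ))
        * (H ^ 2 + c ^ 2 + ‖e t ω - e (t - 1) ω‖ ^ 2)) μ :=
      ((integrable_const _).add hY2).const_mul _
    have hle := integral_mono (integrable_quadGain (T := T) hmem.norm N (H + c) D) hI fun ω => by
      simpa [h0.ne'] using quadGain_le (T := T) (Y := ‖e t ω - e (t - 1) ω‖) h0.le hD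
        (rfl : H + c = H + c)
    refine hle.trans ?_
    rw [integral_const_mul, integral_add (integrable_const _) hY2, integral_const]
    simp only [probReal_univ, one_smul]
    have hk : 3 * D / (4 * N * √(T : ℝ)) * (H ^ 2 + c ^ 2 + ∫ ω, ‖e t ω - e (t - 1) ω‖ ^ 2 ∂μ)
        ≤ 3 * D / (4 * N * √(T : ℝ)) * (H ^ 2 + c ^ 2 + 2 * σ ^ 2) := by gcongr
    refine hk.trans ?_
    have hHN : H ^ 2 / N ≤ H := by rw [div_le_iff₀ h0]; nlinarith
    -- From `N ≥ √3 σ`. With the prefactor `3/4` this produces `√3 / 2 * σ`.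
    have hσN : 2 * σ ^ 2 / N ≤ 2 / 3 * √3 * σ := by
      rw [div_le_iff₀ h0]
      have : √3 * σ * (√3 * σ) ≤ √3 * σ * N := by gcongr; linarith
      nlinarith
    have e1 : 3 * D / (4 * N * √(T : ℝ)) * (H ^ 2 + c ^ 2 + 2 * σ ^ 2)
        = D / √(T : ℝ) * (3 / 4 * (H ^ 2 / N + c ^ 2 / N + 2 * σ ^ 2 / N)) := by
      field_simp
    rw [e1]
    gcongr
    linarith

theorem IsMartingaleDifference.pathBound_expectation (h : IsMartingaleDifference μ 𝒢 σ T e)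
    (hT : 1 ≤ T) (hσ : 0 ≤ σ) {H c N : ℝ} (hH : 0 ≤ H) (hD : 0 < P.diamX)
    (hN : H + √3 * σ ≤ N) (η τ ρ : ℝ) (hx : ∀ t ≤ T, Measurable[𝒢 t] (x t))
    (hxD : ∀ t ≤ T, ∀ ω, ‖x t ω - x 0 ω‖ ≤ P.diamX) :
    Integrable (fun ω => P.pathBound H N (H + c) η τ ρ T (fun t => x t ω) (fun t => e t ω)) μ ∧
    ∫ ω, P.pathBound H N (H + c) η τ ρ T (fun t => x t ω) (fun t => e t ω) ∂μ
      ≤ η / 2 * P.diamX ^ 2 + τ / 2 * ρ ^ 2 + H * P.diamX + 2 * P.diamX * σ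
        + P.diamX * (√(T : ℝ) * σ)
        + √(T : ℝ) * P.diamX * (3 / 4 * H + 3 / 4 * (c ^ 2 / N) + √3 / 2 * σ) := by
  set D := P.diamX with hDdef
  have hZm : ∀ t ≤ T, Measurable[𝒢 t] fun ω => x t ω - x 0 ω := fun t ht =>
    (hx t ht).sub ((hx 0 (by omega)).mono (h.mono (Nat.zero_le t)) le_rfl)
  have hZ : ∀ t ≤ T, MemLp (fun ω => x t ω - x 0 ω) 2 μ := fun t ht =>
    MemLp.of_bound (((hZm t ht).mono (h.le t) le_rfl).aestronglyMeasurable) D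
      (Filter.Eventually.of_forall (hxD t ht))
  have i0 : Integrable (fun ω => D * ‖e 0 ω‖) μ :=
    ((h.memLp 0 (by omega)).norm.integrable one_le_two).const_mul D
  have i1 : Integrable (fun ω => D * ‖e (T - 1) ω‖) μ :=
    ((h.memLp (T - 1) (by omega)).norm.integrable one_le_two).const_mul D
  have i2 : Integrable (fun ω => D * ‖∑ t ∈ Finset.range T, e t ω‖) μ :=
    ((h.memLp_sum le_rfl).norm.integrable one_le_two).const_mul D
  have i3' : ∀ t ∈ Finset.range T, Integrable (fun ω => ⟪e t ω, x t ω - x 0 ω⟫) μ := fun t ht => by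
    rw [Finset.mem_range] at ht
    exact integrable_inner_of_memLp (h.memLp t ht) (hZ t ht.le)
  have i3 : Integrable (fun ω => ∑ t ∈ Finset.range T, ⟪e t ω, x t ω - x 0 ω⟫) μ :=
    integrable_finsetSum _ i3'
  have i4' : ∀ t ∈ Finset.range T,
      Integrable (fun ω => quadGain N (H + c) D T ‖e t ω - e (t - 1) ω‖) μ := fun t ht => by
    rw [Finset.mem_range] at ht
    exact integrable_quadGain (h.memLp_sub ht).norm _ _ _
  have i4 : Integrable (fun ω => ∑ t ∈ Finset.range T,
      quadGain N (H + c) D T ‖e t ω - e (t - 1) ω‖) μ := integrable_finsetSum _ i4'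
  have ic : Integrable (fun _ : Ω => η / 2 * D ^ 2 + τ / 2 * ρ ^ 2 + H * D) μ := integrable_const _
  have j1 := ic.add i0
  have j2 := j1.add i1
  have j3 := j2.add i2
  have j4 := j3.sub i3
  have j5 := j4.add i4
  refine ⟨j5, ?_⟩
  have hs0 : ∀ t < T, ∫ ω, ‖e t ω‖ ∂μ ≤ σ := fun t ht =>
    integral_norm_le_of_sq (h.memLp t ht) hσ (h.integral_sq_le t ht)
  have hs2 : ∫ ω, ‖∑ t ∈ Finset.range T, e t ω‖ ∂μ ≤ √(T : ℝ) * σ :=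
    integral_norm_le_of_sq (h.memLp_sum le_rfl) (by positivity)
      (by rw [mul_pow, Real.sq_sqrt (by positivity)]; exact h.integral_sq_sum_le le_rfl)
  have hs3 : ∫ ω, ∑ t ∈ Finset.range T, ⟪e t ω, x t ω - x 0 ω⟫ ∂μ = 0 := by
    rw [integral_finsetSum _ i3']
    refine Finset.sum_eq_zero fun t ht => ?_
    rw [Finset.mem_range] at ht
    exact h.orthogonal t ht _ (hZm t ht.le) (hZ t ht.le)
  have hs4 : ∫ ω, ∑ t ∈ Finset.range T, quadGain N (H + c) D T ‖e t ω - e (t - 1) ω‖ ∂μ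
      ≤ √(T : ℝ) * D * (3 / 4 * H + 3 / 4 * (c ^ 2 / N) + √3 / 2 * σ) := by
    rw [integral_finsetSum _ i4']
    refine (Finset.sum_le_card_nsmul _ _ _ fun t ht =>
      h.integral_quadGain_le hT hσ hH hD hN (Finset.mem_range.1 ht)).trans_eq ?_
    rw [Finset.card_range, nsmul_eq_mul]
    have hTT : (T : ℝ) = √(T : ℝ) * √(T : ℝ) := (Real.mul_self_sqrt (by positivity)).symm
    have : (T : ℝ) / √(T : ℝ) = √(T : ℝ) := Real.div_sqrt
    rw [← mul_assoc, ← mul_div_assoc, mul_comm (T : ℝ) D, mul_div_assoc, this, mul_comm D]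
  have hsum : ∫ ω, P.pathBound H N (H + c) η τ ρ T (fun t => x t ω) (fun t => e t ω) ∂μ
      = (η / 2 * D ^ 2 + τ / 2 * ρ ^ 2 + H * D) + D * ∫ ω, ‖e 0 ω‖ ∂μ
        + D * ∫ ω, ‖e (T - 1) ω‖ ∂μ + D * ∫ ω, ‖∑ t ∈ Finset.range T, e t ω‖ ∂μ
        - ∫ ω, ∑ t ∈ Finset.range T, ⟪e t ω, x t ω - x 0 ω⟫ ∂μ
        + ∫ ω, ∑ t ∈ Finset.range T, quadGain N (H + c) D T ‖e t ω - e (t - 1) ω‖ ∂μ := by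
    have k5 := integral_add j4 i4
    have k4 := integral_sub j3 i3
    have k3 := integral_add j2 i2
    have k2 := integral_add j1 i1
    have k1 := integral_add ic i0
    simp only [integral_const_mul, integral_const, probReal_univ, one_smul, Pi.add_apply,
      Pi.sub_apply] at k1 k2 k3 k4 k5
    simp only [FCVI.pathBound, ← hDdef]
    linarith
  rw [hsum, hs3]
  have m0 := mul_le_mul_of_nonneg_left (hs0 0 (by omega)) hD.le
  have m1 := mul_le_mul_of_nonneg_left (hs0 (T - 1) (by omega)) hD.le
  have m2 := mul_le_mul_of_nonneg_left hs2 hD.le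
  linarith

end Expectation

/-! ### Averaging, regularity of the error measures, and KKT multipliers. -/

namespace FCVI

variable {n m : ℕ} {P : FCVI n m} {L H Mg : ℝ} {Lc Hc : Fin m → ℝ}

section Deterministic

theorem Standing.exists_bound_F (hP : P.Standing L H Mg Lc Hc) :
    ∃ K : NNReal, ∀ y ∈ P.X, ‖P.F y‖ ≤ K := by
  rcases P.X.eq_empty_or_nonempty with h | ⟨a, ha⟩
  · exact ⟨0, by simp [h]⟩
  · have hL := hP.L_nonneg
    have hH := hP.H_nonneg
    have hD : 0 ≤ P.diamX := Metric.diam_nonneg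
    refine ⟨⟨‖P.F a‖ + (L * P.diamX + H), by positivity⟩, fun y hy => ?_⟩
    have h1 := hP.lipschitz_F y hy a ha
    have h2 := mul_le_mul_of_nonneg_left (hP.norm_sub_le_diamX hy ha) hL
    have h3 := norm_le_norm_add_norm_sub (P.F a) (P.F y)
    rw [norm_sub_rev] at h3
    change _ ≤ ‖P.F a‖ + (L * P.diamX + H)
    linarith

theorem Standing.bddAbove_weakGap (hP : P.Standing L H Mg Lc Hc) (z : Euc n) :
    BddAbove ((fun y => ⟪P.F y, z - y⟫) '' P.feasible) := by
  obtain ⟨K, hK⟩ := hP.exists_bound_F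
  obtain ⟨R, hR⟩ := hP.compact_X.isBounded.exists_norm_le
  refine ⟨K * (‖z‖ + R), ?_⟩
  rintro _ ⟨y, hy, rfl⟩
  refine (real_inner_le_norm _ _).trans ?_
  have h1 := hK y hy.1
  have h2 : ‖z - y‖ ≤ ‖z‖ + R := (norm_sub_le _ _).trans (by linarith [hR y hy.1])
  gcongr

/-- A supremum of affine functions whose slopes `F y` are uniformly bounded is Lipschitz, even
though `F` itself may jump. This gives measurability of the weak gap at the output. -/
theorem Standing.continuous_weakGap (hP : P.Standing L H Mg Lc Hc) (hne : P.feasible.Nonempty) :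
    Continuous P.weakGap := by
  obtain ⟨K, hK⟩ := hP.exists_bound_F
  refine (LipschitzWith.of_le_add_mul K fun z z' => ?_).continuous
  refine csSup_le (hne.image _) ?_
  rintro _ ⟨y, hy, rfl⟩
  have h1 : ⟪P.F y, z' - y⟫ ≤ P.weakGap z' :=
    le_csSup (hP.bddAbove_weakGap z') (Set.mem_image_of_mem _ hy)
  have h2 : ⟪P.F y, z - z'⟫ ≤ K * dist z z' := by
    rw [dist_eq_norm]
    refine (real_inner_le_norm _ _).trans ?_
    have := hK y hy.1
    gcongr
  have h3 : z - y = (z' - y) + (z - z') := by abel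
  simp only [h3, inner_add_right]
  linarith

theorem Standing.continuousOn_infeasibility (hP : P.Standing L H Mg Lc Hc) :
    ContinuousOn P.infeasibility P.X := by
  have h : Continuous (vecPosPart : Euc m → Euc m) :=
    (PiLp.continuous_toLp 2 _).comp (by fun_prop)
  exact (h.comp_continuousOn hP.continuous_g).norm

theorem weightedOutput_one_eq {x : ℕ → Euc n} {T : ℕ} :
    weightedOutput (fun _ => 1) x T
      = (Finset.range T).centerMass (fun _ => (1 : ℝ)) fun t => x (t + 1) := rfl

theorem Standing.weightedOutput_mem (hP : P.Standing L H Mg Lc Hc) {x : ℕ → Euc n} {T : ℕ}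
    (hT : 1 ≤ T) (hx : ∀ t < T, x (t + 1) ∈ P.X) : weightedOutput (fun _ => 1) x T ∈ P.X := by
  rw [weightedOutput_one_eq]
  refine hP.convex_X.centerMass_mem (fun _ _ => zero_le_one) ?_
    fun t ht => hx t (Finset.mem_range.1 ht)
  simp; omega

/-- Saddle gap of the averaged output, bounded by the accumulated saddle gap. -/
theorem Standing.gap_weightedOutput_le (hP : P.Standing L H Mg Lc Hc) {x : ℕ → Euc n} {T : ℕ}
    (hT : 1 ≤ T) (hx : ∀ t < T, x (t + 1) ∈ P.X) {z : Euc n} (hz : z ∈ P.X) {u : Euc m}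
    (hu : u ∈ nonnegOrthant m) :
    T * (⟪P.F z, weightedOutput (fun _ => 1) x T - z⟫
        + ⟪u, P.g (weightedOutput (fun _ => 1) x T)⟫)
      ≤ ∑ t ∈ Finset.range T, (⟪P.F (x (t + 1)), x (t + 1) - z⟫ + ⟪u, P.g (x (t + 1))⟫) := by
  have hT0 : (0 : ℝ) < T := by exact_mod_cast hT
  have hsum : ∑ t ∈ Finset.range T, (1 : ℝ) = T := by simp
  have e1 : (T : ℝ) • weightedOutput (fun _ => 1) x T = ∑ t ∈ Finset.range T, x (t + 1) := by
    simp [weightedOutput, smul_smul, hT0.ne']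
  have h1 : T * ⟪P.F z, weightedOutput (fun _ => 1) x T - z⟫
      = ∑ t ∈ Finset.range T, ⟪P.F z, x (t + 1) - z⟫ := by
    rw [← real_inner_smul_right, smul_sub, e1, ← inner_sum, Finset.sum_sub_distrib]
    simp [Nat.cast_smul_eq_nsmul]
  have h2 : ∑ t ∈ Finset.range T, ⟪P.F z, x (t + 1) - z⟫
      ≤ ∑ t ∈ Finset.range T, ⟪P.F (x (t + 1)), x (t + 1) - z⟫ := by
    refine Finset.sum_le_sum fun t ht => ?_
    have := hP.monotone_F _ (hx t (Finset.mem_range.1 ht)) z hz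
    rw [inner_sub_left] at this
    linarith
  have h3 : T * ⟪u, P.g (weightedOutput (fun _ => 1) x T)⟫
      ≤ ∑ t ∈ Finset.range T, ⟪u, P.g (x (t + 1))⟫ := by
    simp_rw [inner_euc]
    rw [Finset.sum_comm, Finset.mul_sum]
    refine Finset.sum_le_sum fun j _ => ?_
    have h := (hP.convex_g j).map_centerMass_le (t := Finset.range T) (w := fun _ => (1 : ℝ))
      (p := fun t => x (t + 1)) (fun _ _ => zero_le_one) (by rw [hsum]; exact hT0)
      fun t ht => hx t (Finset.mem_range.1 ht)
    rw [← weightedOutput_one_eq, Finset.centerMass, hsum] at h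
    simp only [Function.comp, smul_eq_mul, one_mul] at h
    rw [inv_mul_eq_div, le_div_iff₀ hT0] at h
    rw [← Finset.mul_sum]
    have := mul_le_mul_of_nonneg_left h (hu j)
    linarith
  rw [Finset.sum_add_distrib, mul_add]
  linarith

theorem IsKKT.inner_F_ge {xs : Euc n} {ls : Euc m} (h : P.IsKKT xs ls) {y : Euc n}
    (hy : y ∈ P.X) : -⟪ls, P.g y⟫ ≤ ⟪P.F xs, y - xs⟫ := by
  obtain ⟨v, w, hw, hv, h0⟩ := h.stationary
  have e : P.F xs = -(∑ j, ls j • v j + w) := by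
    rw [eq_neg_iff_add_eq_zero, ← add_assoc]; exact h0
  have h1 : ⟪∑ j, ls j • v j, y - xs⟫ ≤ ⟪ls, P.g y⟫ := by
    rw [sum_inner, inner_euc]
    refine Finset.sum_le_sum fun j _ => ?_
    rw [real_inner_smul_left]
    have h2 := mul_le_mul_of_nonneg_left (hv j y hy) (h.dual_feasible j)
    have h3 := h.complementary j
    linarith
  rw [e, inner_neg_left, inner_add_left]
  linarith [hw y hy]

theorem inner_vecPosPart (v : Euc m) : ⟪vecPosPart v, v⟫ = ‖vecPosPart v‖ ^ 2 := by
  rw [← real_inner_self_eq_norm_sq, inner_euc, inner_euc]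
  refine Finset.sum_congr rfl fun j _ => ?_
  simp only [vecPosPart]
  rcases le_total (v j) 0 with h | h
  · simp [h]
  · simp [h]

/-- The multiplier that exposes the infeasibility of a point. -/
theorem IsKKT.infeasibility_le {xs : Euc n} {ls : Euc m} (h : P.IsKKT xs ls) {y : Euc n}
    (hy : y ∈ P.X) : ∃ u ∈ nonnegOrthant m, ‖u‖ ≤ ‖ls‖ + 1 ∧
      P.infeasibility y ≤ ⟪P.F xs, y - xs⟫ + ⟪u, P.g y⟫ := by
  set v := vecPosPart (P.g y) with hv
  have hv0 : ∀ j, 0 ≤ v j := fun j => le_max_right _ _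
  have hc : 0 ≤ (‖ls‖ + 1) * ‖v‖⁻¹ := by positivity
  -- Pairing with `g` gains `(‖ls‖ + 1) ‖v‖`, while the KKT inequality loses at most `‖ls‖ ‖v‖`,
  -- leaving `‖v‖`. If `v = 0` the witness is `0`.
  refine ⟨((‖ls‖ + 1) * ‖v‖⁻¹) • v, fun j => ?_, ?_, ?_⟩
  · simpa using mul_nonneg hc (hv0 j)
  · rw [norm_smul, Real.norm_of_nonneg hc, mul_assoc]
    exact mul_le_of_le_one_right (by positivity) (inv_mul_le_one)
  · have e : ⟪((‖ls‖ + 1) * ‖v‖⁻¹) • v, P.g y⟫ = (‖ls‖ + 1) * ‖v‖ := by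
      rw [real_inner_smul_left, hv, inner_vecPosPart, ← hv]
      rcases eq_or_ne ‖v‖ 0 with h0 | h0
      · simp [h0]
      · field_simp
    have h1 := h.inner_F_ge hy
    have h2 : ⟪ls, P.g y⟫ ≤ ⟪ls, v⟫ := by
      rw [← sub_nonneg, ← inner_sub_right]
      refine inner_nonneg_of_nonneg h.dual_feasible fun j => ?_
      simp [hv, vecPosPart]
    have h3 := real_inner_le_norm ls v
    rw [e]
    change ‖v‖ ≤ _
    linarith

end Deterministic

section Stochastic

variable {Ω Ξ : Type*} [MeasurableSpace Ξ] {ν : Measure Ξ} {Fr : Euc n → Ξ → Euc n} {σ : ℝ}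
  {mΩ : MeasurableSpace Ω} {μ : Measure Ω} [IsProbabilityMeasure μ] {ξ : ℕ → Ω → Ξ}

theorem IsOracle.isMartingaleDifference (h : P.IsOracle ν Fr σ) (hXm : MeasurableSet P.X)
    (hξ : ∀ t, Measurable (ξ t)) (hlaw : ∀ t, μ.map (ξ t) = ν) (hi : iIndepFun ξ μ)
    {x : ℕ → Ω → Euc n} {T : ℕ} (hx : ∀ t ≤ T, Measurable[past ξ t] (x t))
    (hX : ∀ t ≤ T, ∀ ω, x t ω ∈ P.X) :
    IsMartingaleDifference μ (past ξ) σ T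
      fun t ω => P.noise Fr (fun s => x s ω) (fun s => ξ s ω) t := by
  have hν : IsProbabilityMeasure ν := by
    rw [← hlaw 0]; exact Measure.isProbabilityMeasure_map (hξ 0).aemeasurable
  have hxm : ∀ t ≤ T, Measurable (x t) := fun t ht => (hx t ht).mono (past_le hξ t) le_rfl
  have hm : ∀ t < T, Measurable[past ξ (t + 1)]
      fun ω => P.noise Fr (fun s => x s ω) (fun s => ξ s ω) t := fun t ht => by
    have h1 : Measurable[past ξ (t + 1)] (x t) :=
      (hx t ht.le).mono (past_mono ξ (Nat.le_succ t)) le_rfl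
    exact (h.measurable.comp (h1.prodMk (measurable_past ξ (Nat.lt_succ_self t)))).sub
      (h.measurable_F_comp (mΩ := past ξ (t + 1)) h1 (hX t ht.le))
  have hsq : ∀ t < T, _ := fun t ht =>
    integrable_sq_and_integral_le ((hm t ht).mono (past_le hξ _) le_rfl) (sq_nonneg σ)
      (h.lintegral_noise_le hXm (hxm t ht.le) (hX t ht.le) (hξ t) (hlaw t)
        (indepFun_past hξ hi (hx t ht.le)))
  refine ⟨fun s t hst => past_mono ξ hst, past_le hξ, hm, fun t ht => (hsq t ht).1,
    fun t ht => (hsq t ht).2, fun t ht Z hZ hZ2 => ?_⟩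
  exact h.integral_inner_noise_eq_zero hXm (hxm t ht.le) (hX t ht.le)
    (hZ.mono (past_le hξ t) le_rfl) (hξ t) (hlaw t)
    (indepFun_past hξ hi ((hx t ht.le).prodMk hZ)) (integrable_inner_of_memLp (hsq t ht).1 hZ2)

end Stochastic

end FCVI

/-! ### Numerical constants and sample complexity. -/

theorem le_div_add_div_sqrt {T : ℕ} (hT : 1 ≤ T) {I a b : ℝ} (h : T * I ≤ a + b * √(T : ℝ)) :
    I ≤ a / T + b / √(T : ℝ) := by
  have hT0 : (0 : ℝ) < T := by exact_mod_cast hT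
  have e : a / T + b / √(T : ℝ) = (a + b * √(T : ℝ)) / T := by
    rw [add_div, mul_div_assoc, Real.sqrt_div_self', mul_one_div]
  rw [e, le_div_iff₀ hT0]
  linarith

theorem div_add_div_sqrt_le {T : ℕ} (hT : 1 ≤ T) {a b c ε : ℝ} (ha : 0 ≤ a) (hε : 0 < ε)
    (hc : a + b ≤ c) (h : c ^ 2 / ε ^ 2 ≤ T) : a / T + b / √(T : ℝ) ≤ ε := by
  have hT1 : (1 : ℝ) ≤ √(T : ℝ) := Real.one_le_sqrt.2 (by exact_mod_cast hT)
  have hT0 : 0 < √(T : ℝ) := by linarith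
  have hTT : √(T : ℝ) ^ 2 = T := Real.sq_sqrt (by positivity)
  have h1 : a / T ≤ a / √(T : ℝ) := by
    gcongr
    nlinarith
  have h2 : c ≤ √(T : ℝ) * ε := by
    refine (le_abs_self c).trans (abs_le_of_sq_le_sq ?_ (by positivity))
    rw [div_le_iff₀ (by positivity)] at h
    rw [mul_pow, hTT]
    exact h
  have h3 : a / √(T : ℝ) + b / √(T : ℝ) ≤ ε := by
    rw [← add_div, div_le_iff₀ hT0]
    linarith
  linarith

theorem half_primalStep_mul_sq (L Lg Mg H Hg σ B : ℝ) {D : ℝ} (hD : 0 < D) (T : ℕ) :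
    primalStep L Lg Mg H Hg σ D B T / 2 * D ^ 2 = B * Lg * D ^ 2 / 2 + 4 * L * D ^ 2
      + 5 / 2 * (Mg * D * B) + (H + Hg * B + √3 * σ) * D * √(T : ℝ) := by
  unfold primalStep
  field_simp
  ring

/-- The square `(-1 + 1) ^ 2` is the multiplier radius `r + 1` at `r = -1`, the case `u = 0`. The
`r` of the conclusion is free because its term is nonnegative. -/
theorem gap_constants_le {L Lg Mg H Hg σ D B r c I : ℝ} {T : ℕ} (hT : 1 ≤ T) (hL : 0 ≤ L)
    (hLg : 0 ≤ Lg) (hMg : 0 ≤ Mg) (hH : 0 ≤ H) (hHg : 0 ≤ Hg) (hσ : 0 ≤ σ) (hD : 0 < D)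
    (hB : 0 < B) (hc : c = 0)
    (h : T * I ≤ primalStep L Lg Mg H Hg σ D B T / 2 * D ^ 2 + dualStep Mg D B / 2 * (-1 + 1) ^ 2
      + H * D + 2 * D * σ + D * (√(T : ℝ) * σ) + √(T : ℝ) * D
        * (3 / 4 * H + 3 / 4 * (c ^ 2 / (H + Hg * B + √3 * σ)) + √3 / 2 * σ)) :
    I ≤ gapCoeffT L Lg Mg D B r / T + gapCoeffSqrt H Hg σ D B / √(T : ℝ) := by
  refine le_div_add_div_sqrt hT (h.trans ?_)
  rw [half_primalStep_mul_sq _ _ _ _ _ _ _ hD, hc]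
  have hT1 : (1 : ℝ) ≤ √(T : ℝ) := Real.one_le_sqrt.2 (by exact_mod_cast hT)
  have h3 : (1.7 : ℝ) ≤ √3 := Real.le_sqrt_of_sq_le (by norm_num)
  unfold gapCoeffT gapCoeffSqrt
  set S := √(T : ℝ)
  have p1 : 0 ≤ L * D ^ 2 := by positivity
  have p2 : 0 ≤ B * Lg * D ^ 2 := by positivity
  have p3 : 0 ≤ Mg * D * B := by positivity
  have p4 : 0 ≤ Mg * D * ((r + 1) ^ 2 / B) := by positivity
  have p5 : 0 ≤ H * D * (S - 1) := mul_nonneg (by positivity) (by linarith)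
  have p6 : 0 ≤ σ * D * (S - 1) := mul_nonneg (by positivity) (by linarith)
  have p7 : 0 ≤ Hg * B * D * S := by positivity
  have p8 : 0 ≤ H * D := by positivity
  have p9 : 0 ≤ σ * D * S * (√3 - 1.7) := mul_nonneg (by positivity) (by linarith)
  have p10 : 0 ≤ σ * D * S := by positivity
  norm_num
  linarith

theorem feas_constants_le {L Lg Mg H Hg σ D B r I : ℝ} {T : ℕ} (hT : 1 ≤ T)
    (hMg : 0 ≤ Mg) (hH : 0 ≤ H) (hHg : 0 ≤ Hg) (hσ : 0 ≤ σ) (hD : 0 < D) (hB : 0 < B)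
    (h : T * I ≤ primalStep L Lg Mg H Hg σ D B T / 2 * D ^ 2 + dualStep Mg D B / 2 * (r + 1) ^ 2
      + H * D + 2 * D * σ + D * (√(T : ℝ) * σ) + √(T : ℝ) * D
        * (3 / 4 * H + 3 / 4 * (calH Lg Hg D B r ^ 2 / (H + Hg * B + √3 * σ)) + √3 / 2 * σ)) :
    I ≤ feasCoeffT L Lg Mg D B r / T + feasCoeffSqrt Lg H Hg σ D B r / √(T : ℝ) := by
  refine le_div_add_div_sqrt hT (h.trans ?_)
  rw [half_primalStep_mul_sq _ _ _ _ _ _ _ hD]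
  have hT1 : (1 : ℝ) ≤ √(T : ℝ) := Real.one_le_sqrt.2 (by exact_mod_cast hT)
  -- After `√T ≥ 1` moves the terms free of `√T` into the main order, the `σ`-terms require `3 +
  -- (3/2) √3 ≤ 4 √2`, about `5.598` against `5.657`; the margin is narrow.
  have h3 : √3 ≤ (1.733 : ℝ) := Real.sqrt_le_iff.2 (by norm_num)
  have h2 : (1.41 : ℝ) ≤ √2 := Real.le_sqrt_of_sq_le (by norm_num)
  unfold feasCoeffT feasCoeffSqrt dualStep
  have hq : 0 ≤ calH Lg Hg D B r ^ 2 / (H + Hg * B + √3 * σ) := by positivity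
  set q := calH Lg Hg D B r ^ 2 / (H + Hg * B + √3 * σ)
  set S := √(T : ℝ)
  have p3 : 0 ≤ Mg * D * B := by positivity
  have e4 : 6 * Mg * D / B / 2 * (r + 1) ^ 2 = 3 * (Mg * D * ((r + 1) ^ 2 / B)) := by ring
  have p5 : 0 ≤ H * D * (S - 1) := mul_nonneg (by positivity) (by linarith)
  have p6 : 0 ≤ σ * D * (S - 1) := mul_nonneg (by positivity) (by linarith)
  have p7 : 0 ≤ D * S * q := by positivity
  have p8 : 0 ≤ H * D := by positivity
  have p9 : 0 ≤ σ * D * S * (1.733 - √3) := mul_nonneg (by positivity) (by linarith)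
  have p11 : 0 ≤ σ * D * S * (√2 - 1.41) := mul_nonneg (by positivity) (by linarith)
  have p10 : 0 ≤ σ * D * S := by positivity
  rw [e4]
  norm_num at *
  linarith

/-! ### Assembly of the two bounds. -/

theorem FCVI.integrable_comp_of_continuousOn {n : ℕ} {X : Set (Euc n)} (hX : IsCompact X)
    {Ω : Type*} {mΩ : MeasurableSpace Ω} {μ : Measure Ω} [IsFiniteMeasure μ] {y : Ω → Euc n}
    (hyX : ∀ ω, y ω ∈ X) {f : Euc n → ℝ} (hf : ContinuousOn f X)
    (hfm : Measurable fun ω => f (y ω)) : Integrable (fun ω => f (y ω)) μ := by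
  obtain ⟨C, hC⟩ := hX.exists_bound_of_continuousOn hf
  exact Integrable.of_bound hfm.aestronglyMeasurable C
    (Filter.Eventually.of_forall fun ω => hC _ (hyX ω))

theorem mainTheorem3 {n m : ℕ} (P : FCVI n m) (L H Mg : ℝ) (Lc Hc : Fin m → ℝ)
    (hP : P.Standing L H Mg Lc Hc) (hD : 0 < P.diamX)
    (xs : Euc n) (ls : Euc m) (hKKT : P.IsKKT xs ls)
    {Ξ : Type*} [MeasurableSpace Ξ] (ν : Measure Ξ) (Fr : Euc n → Ξ → Euc n)
    (σ : ℝ) (hσ : 0 ≤ σ) (hFr : P.IsOracle ν Fr σ)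
    {Ω : Type*} [MeasurableSpace Ω] (μ : Measure Ω) [IsProbabilityMeasure μ]
    (ξ : ℕ → Ω → Ξ) (hξ_meas : ∀ t, Measurable (ξ t)) (hξ_law : ∀ t, μ.map (ξ t) = ν)
    (hξ_indep : iIndepFun ξ μ)
    (B : ℝ) (hB : 1 ≤ B) (T : ℕ) (hT : 1 ≤ T) (x0 : Euc n) (hx0 : x0 ∈ P.X)
    (x : ℕ → Ω → Euc n) (l : ℕ → Ω → Euc m)
    (hrun : ∀ ω, P.IsStOpConExRun Fr x0 (fun _ => 1)
      (fun _ => primalStep L (l2Combine Lc) Mg H (l2Combine Hc) σ P.diamX B T)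
      (fun _ => dualStep Mg P.diamX B) T
      (fun t => ξ t ω) (fun t => x t ω) (fun t => l t ω)) :
    (Integrable (fun ω => P.weakGap (weightedOutput (fun _ => 1) (fun t => x t ω) T)) μ ∧
      ∫ ω, P.weakGap (weightedOutput (fun _ => 1) (fun t => x t ω) T) ∂μ ≤
        gapCoeffT L (l2Combine Lc) Mg P.diamX B ‖ls‖ / T
          + gapCoeffSqrt H (l2Combine Hc) σ P.diamX B / √(T : ℝ)) ∧
    ((0 < H + l2Combine Hc * B + √3 * σ ∨
        calH (l2Combine Lc) (l2Combine Hc) P.diamX B ‖ls‖ = 0) →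
      (Integrable (fun ω => P.infeasibility
          (weightedOutput (fun _ => 1) (fun t => x t ω) T)) μ ∧
        ∫ ω, P.infeasibility (weightedOutput (fun _ => 1) (fun t => x t ω) T) ∂μ ≤
          feasCoeffT L (l2Combine Lc) Mg P.diamX B ‖ls‖ / T
            + feasCoeffSqrt (l2Combine Lc) H (l2Combine Hc) σ P.diamX B ‖ls‖ / √(T : ℝ)) ∧
      ∀ ε : ℝ, 0 < ε →
        (max (gapCoeffT L (l2Combine Lc) Mg P.diamX B ‖ls‖
              + gapCoeffSqrt H (l2Combine Hc) σ P.diamX B)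
            (feasCoeffT L (l2Combine Lc) Mg P.diamX B ‖ls‖
              + feasCoeffSqrt (l2Combine Lc) H (l2Combine Hc) σ P.diamX B ‖ls‖)) ^ 2 / ε ^ 2
          ≤ T →
        P.IsStochSolution μ
          (fun ω => weightedOutput (fun _ => 1) (fun t => x t ω) T) ε) := by
  set D := P.diamX with hDdef
  set Lg := l2Combine Lc with hLg
  set Hg := l2Combine Hc with hHg
  set η := primalStep L Lg Mg H Hg σ D B T with hη
  set τ := dualStep Mg D B with hτ
  have hB0 : 0 < B := by linarith
  have hL := hP.L_nonneg
  have hH := hP.H_nonneg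
  have hMg := hP.Mg_pos
  have hLg0 : 0 ≤ Lg := l2Combine_nonneg Lc
  have hHg0 : 0 ≤ Hg := l2Combine_nonneg Hc
  have hT0 : (0 : ℝ) < T := by exact_mod_cast hT
  have hη0 : 0 < η := by simp only [hη, primalStep]; positivity
  have hτ0 : 0 < τ := by simp only [hτ, dualStep]; positivity
  have hN : H + √3 * σ ≤ H + Hg * B + √3 * σ := by
    have : 0 ≤ Hg * B := by positivity
    linarith
  have hXm : MeasurableSet P.X := hP.compact_X.isClosed.measurableSet
  have hX : ∀ t ≤ T, ∀ ω, x t ω ∈ P.X := fun t ht ω => (hrun ω).mem_X hx0 ht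
  have hxm : ∀ t ≤ T, Measurable[FCVI.past ξ t] (x t) := fun t ht =>
    (hP.measurable_run hFr.measurable hx0 hη0 hτ0 hrun ht).1
  have hmd := hFr.isMartingaleDifference hXm hξ_meas hξ_law hξ_indep hxm hX
  have hE := fun r => hmd.pathBound_expectation (P := P) hT hσ
    (c := calH Lg Hg D B r) hH hD hN η τ (r + 1) hxm
    (fun t ht ω => hP.norm_sub_le_diamX (hX t ht ω) (hX 0 (by omega) ω))
  set y : Ω → Euc n := fun ω => weightedOutput (fun _ => 1) (fun t => x t ω) T with hy
  have hyX : ∀ ω, y ω ∈ P.X := fun ω => hP.weightedOutput_mem hT fun t ht => hX (t + 1) ht ω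
  have hym : Measurable y := by
    refine Measurable.fun_const_smul (Finset.measurable_fun_sum _ fun t ht => ?_) _
    exact ((hxm (t + 1) (Finset.mem_range.1 ht)).mono
      (FCVI.past_le hξ_meas _) le_rfl).fun_const_smul _
  have hpath : ∀ r, (H + Hg * B + √3 * σ = 0 → calH Lg Hg D B r = 0) → ∀ ω, ∀ z ∈ P.feasible,
      ∀ u ∈ nonnegOrthant m, ‖u‖ ≤ r + 1 →
      ⟪P.F z, y ω - z⟫ + ⟪u, P.g (y ω)⟫ ≤ (T : ℝ)⁻¹ * P.pathBound H (H + Hg * B + √3 * σ)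
        (H + calH Lg Hg D B r) η τ (r + 1) T (fun t => x t ω)
        (fun t => P.noise Fr (fun s => x s ω) (fun s => ξ s ω) t) := by
    intro r hr ω z hz u hu hur
    rw [inv_mul_eq_div, le_div_iff₀ hT0, mul_comm]
    exact (hP.gap_weightedOutput_le (x := fun t => x t ω) hT (fun t ht => hX (t + 1) ht ω)
      hz.1 hu).trans (hP.sum_le_pathBound hD hx0 hB hσ hT (hrun ω) hr hz hu hur)
  have hint : ∀ (r : ℝ) (Q : Ω → ℝ), Integrable Q μ →
      (∀ ω, Q ω ≤ (T : ℝ)⁻¹ * P.pathBound H (H + Hg * B + √3 * σ)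
        (H + calH Lg Hg D B r) η τ (r + 1) T (fun t => x t ω)
        (fun t => P.noise Fr (fun s => x s ω) (fun s => ξ s ω) t)) →
      T * ∫ ω, Q ω ∂μ ≤ η / 2 * D ^ 2 + τ / 2 * (r + 1) ^ 2 + H * D + 2 * D * σ
        + D * (√(T : ℝ) * σ) + √(T : ℝ) * D * (3 / 4 * H
          + 3 / 4 * (calH Lg Hg D B r ^ 2 / (H + Hg * B + √3 * σ)) + √3 / 2 * σ) := by
    intro r Q hQ hle
    have h1 := integral_mono hQ ((hE r).1.const_mul _) hle
    rw [integral_const_mul, inv_mul_eq_div, le_div_iff₀ hT0, mul_comm] at h1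
    exact h1.trans (hE r).2
  have hwc := hP.continuous_weakGap ⟨xs, hKKT.primal_feasible⟩
  have hwi : Integrable (fun ω => P.weakGap (y ω)) μ :=
    FCVI.integrable_comp_of_continuousOn hP.compact_X hyX hwc.continuousOn
      (hwc.measurable.comp hym)
  -- At `r = -1` only `u = 0` is admitted and `calH` vanishes, so the weak gap bound needs no
  -- condition on `N`.
  have hcal0 : calH Lg Hg D B (-1) = 0 := by
    simp [calH, hB0.le]
  have hgap : ∫ ω, P.weakGap (y ω) ∂μ
      ≤ gapCoeffT L Lg Mg D B ‖ls‖ / T + gapCoeffSqrt H Hg σ D B / √(T : ℝ) := by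
    refine gap_constants_le hT hL hLg0 hMg.le hH hHg0 hσ hD hB0 hcal0
      (hint (-1) _ hwi fun ω => ?_)
    refine csSup_le (Set.Nonempty.image _ ⟨xs, hKKT.primal_feasible⟩) ?_
    rintro _ ⟨z, hz, rfl⟩
    simpa using hpath (-1) (fun _ => hcal0) ω z hz 0 zero_mem_nonnegOrthant (by simp)
  refine ⟨⟨hwi, hgap⟩, fun hcond => ?_⟩
  have hgm : Measurable fun ω => P.infeasibility (y ω) := by
    refine (Measurable.norm ?_)
    exact (PiLp.continuous_toLp 2 _).measurable.comp (measurable_pi_iff.2 fun j =>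
      ((EuclideanSpace.proj j : Euc m →L[ℝ] ℝ).continuous.measurable.comp
        (measurable_comp_of_continuousOn hP.compact_X.isClosed hP.continuous_g hym hyX)).max
        measurable_const)
  have hfi : Integrable (fun ω => P.infeasibility (y ω)) μ :=
    FCVI.integrable_comp_of_continuousOn hP.compact_X hyX hP.continuousOn_infeasibility hgm
  have hfeas : ∫ ω, P.infeasibility (y ω) ∂μ
      ≤ feasCoeffT L Lg Mg D B ‖ls‖ / T + feasCoeffSqrt Lg H Hg σ D B ‖ls‖ / √(T : ℝ) := by
    refine feas_constants_le hT hMg.le hH hHg0 hσ hD hB0 (hint ‖ls‖ _ hfi fun ω => ?_)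
    -- The multiplier depends on `ω`; this is harmless because the pathwise bound holds for all
    -- admissible `u` simultaneously.
    obtain ⟨u, hu, hur, hle⟩ := hKKT.infeasibility_le (hyX ω)
    exact hle.trans (hpath ‖ls‖ (fun h0 => hcond.resolve_left (by rw [h0]; exact lt_irrefl 0)) ω xs
      hKKT.primal_feasible u hu hur)
  refine ⟨⟨hfi, hfeas⟩, fun ε hε hTε => ⟨⟨hwi, hgap.trans ?_⟩, ⟨hfi, hfeas.trans ?_⟩⟩⟩
  · refine div_add_div_sqrt_le hT ?_ hε (le_max_left _ _) hTε
    unfold gapCoeffT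
    positivity
  · refine div_add_div_sqrt_le hT ?_ hε (le_max_right _ _) hTε
    unfold feasCoeffT
    positivity
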